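/- A *constraint* of arity $k$ is a function $C:\{0,1\}^k\to\{0,1\}$. It is *affine* if it is equivalent to a conjunction of clauses each of which is an exclusive or of literals (variables or negated variables), and *bijunctive* if it is equivalent to a conjunction of clauses each of which is a disjunction of at most two literals; empty conjunctions and empty clauses are allowed. A finite set $\mathcal C$ of constraints is affine (bijunctive) if every $C\in\mathcal C$ is affine (bijunctive). A *constraint application of $\mathcal C$ with constants* over a finite set $X$ of variables is an expression $C(x_1,\dots,x_k)$, where $C\in\mathcal C$ has arity $k$ and each $x_i$ is an element of $X$ (repetitions allowed) or one of the constants $0,1$. $\mathrm{ISO}_c(\mathcal C)$ is the following problem: given a finite set $X$ of variables and two finite sets $S$ and $U$ of constraint applications of $\mathcal C$ with constants over $X$, decide whether there is a permutation $\pi$ of $X$ such that $\pi(S)$ and $U$ are satisfied by the same assignments $X\to\{0,1\}$; here $\pi(S)$ results from $S$ by simultaneously replacing every variable $x$ by $\pi(x)$, and an assignment satisfies a set if it satisfies every member. $\mathrm{GI}$ is the problem to decide whether two given finite simple undirected graphs are isomorphic. **Theorem.** Let $\mathcal C$ be a finite set of constraints. If $\mathcal C$ is affine but not bijunctive, then $\mathrm{GI}$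 is polynomial-time many-one reducible to $\mathrm{ISO}_c(\mathcal C)$, that is, there is a polynomial-time computable function $f$ from instances of $\mathrm{GI}$ to instances of $\mathrm{ISO}_c(\mathcal C)$ such that two graphs $G$ and $H$ are isomorphic if and only if $f(G,H)$ is a yes-instance of $\mathrm{ISO}_c(\mathcal C)$. -/

import Mathlib

namespace BoolIso

/-! ### Decision problems and polynomial-time many-one reductions -/

/-- A decision problem: a type of instances, an injective encoding of the instances as words over
a finite alphabet, and the set of yes-instances. -/
structure Problem where
  Instance : Type
  Alphabet : Type
  alphabet_finite : Finite Alphabet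
  encode : Instance → List Alphabet
  encode_injective : Function.Injective encode
  IsYes : Instance → Prop

/-- Polynomial-time many-one reducibility: some function from instances of `A` to instances of `B`
is computed by a (multi-stack) Turing machine in a number of steps that is bounded by a polynomial
in the length of the input word, and it preserves and reflects yes-instances. -/
def PolyTimeManyOneReducible (A B : Problem) : Prop :=
  ∃ f : A.Instance → B.Instance,
    Nonempty (Turing.TM2ComputableInPolyTime A.encode B.encode f) ∧
      ∀ x, A.IsYes x ↔ B.IsYes (f x)

/-! ### Prefix codes (only used to see that the encodings below are injective) -/

/-- The word `e a` can be read off unambiguously from the beginning of a longer word. -/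
def PrefixCode {α Γ : Type} (e : α → List Γ) : Prop :=
  ∀ a b r s, e a ++ r = e b ++ s → a = b ∧ r = s

theorem PrefixCode.injective {α Γ : Type} {e : α → List Γ} (h : PrefixCode e) :
    Function.Injective e := fun a b hab => (h a b [] [] (by rw [hab])).1

theorem PrefixCode.list {α Γ : Type} {e : α → List Γ} (h : PrefixCode e) (t : Γ)
    (ht : ∀ a r s, e a ++ r ≠ t :: s) : PrefixCode (fun l : List α => l.flatMap e ++ [t]) := by
  intro a
  induction a with
  | nil =>
    intro b r s hab
    cases b with
    | nil => simpa using hab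
    | cons y ys =>
      simp only [List.flatMap_nil, List.flatMap_cons, List.nil_append, List.append_assoc,
        List.cons_append] at hab
      exact absurd hab.symm (ht _ _ _)
  | cons x xs ih =>
    intro b r s hab
    cases b with
    | nil =>
      simp only [List.flatMap_nil, List.flatMap_cons, List.nil_append, List.append_assoc,
        List.cons_append] at hab
      exact absurd hab (ht _ _ _)
    | cons y ys =>
      simp only [List.flatMap_cons, List.append_assoc] at hab
      obtain ⟨rfl, h2⟩ := h _ _ _ _ hab
      obtain ⟨rfl, h3⟩ := ih ys r s (by simpa only [List.append_assoc] using h2)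
      exact ⟨rfl, h3⟩

theorem PrefixCode.family {ι α Γ : Type} {e : α → List Γ} (h : PrefixCode e) (l : List ι)
    (f g : ι → α) (r s : List Γ)
    (hfg : l.flatMap (fun i => e (f i)) ++ r = l.flatMap (fun i => e (g i)) ++ s) :
    (∀ i ∈ l, f i = g i) ∧ r = s := by
  induction l with
  | nil => simpa using hfg
  | cons x xs ih =>
    simp only [List.flatMap_cons, List.append_assoc] at hfg
    obtain ⟨h1, h2⟩ := h _ _ _ _ hfg
    obtain ⟨h3, h4⟩ := ih h2
    exact ⟨by simpa [h1] using h3, h4⟩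

theorem replicate_code {Γ : Type} {t u : Γ} (htu : t ≠ u) :
    PrefixCode (fun n : ℕ => List.replicate n t ++ [u]) := by
  intro a
  induction a with
  | zero =>
    intro b r s hab
    cases b with
    | zero => simpa using hab
    | succ b => simp [List.replicate_succ, htu.symm] at hab
  | succ a ih =>
    intro b r s hab
    cases b with
    | zero => simp [List.replicate_succ, htu] at hab
    | succ b =>
      simp only [List.replicate_succ, List.cons_append, List.cons.injEq, true_and] at hab
      obtain ⟨rfl, h2⟩ := ih b r s hab
      exact ⟨rfl, h2⟩

/-! ### The graph isomorphism problem -/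

/-- An instance of graph isomorphism: two finite simple graphs, on the vertex sets
`{0, …, m - 1}` and `{0, …, n - 1}`. -/
structure GraphPair where
  m : ℕ
  n : ℕ
  G : SimpleGraph (Fin m)
  H : SimpleGraph (Fin n)

/-- Symbols for writing down graphs. -/
inductive GraphSymbol : Type
  | bit (b : Bool)
  | endRow
  | endGraph

theorem GraphSymbol.finite : Finite GraphSymbol := by
  refine Finite.of_injective
    (fun x : GraphSymbol => match x with
      | .bit b => (some (some b) : Option (Option Bool))
      | .endRow => some none
      | .endGraph => none) ?_
  intro x y h
  cases x <;> cases y <;> simp_all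

/-- The row of the vertex `i` in the adjacency matrix of `G`. -/
noncomputable def adjRow {n : ℕ} (G : SimpleGraph (Fin n)) (i : Fin n) : List Bool :=
  open Classical in (List.finRange n).map fun j => decide (G.Adj i j)

/-- A row of bits, followed by an end marker. -/
def encodeRow (l : List Bool) : List GraphSymbol :=
  l.flatMap (fun b => [GraphSymbol.bit b]) ++ [GraphSymbol.endRow]

/-- The adjacency matrix of a graph, row by row, followed by an end marker. -/
noncomputable def encodeGraph {n : ℕ} (G : SimpleGraph (Fin n)) : List GraphSymbol :=
  ((List.finRange n).map (adjRow G)).flatMap encodeRow ++ [GraphSymbol.endGraph]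

noncomputable def GraphPair.encode (x : GraphPair) : List GraphSymbol :=
  encodeGraph x.G ++ encodeGraph x.H

theorem encodeRow_code : PrefixCode encodeRow := by
  refine PrefixCode.list (e := fun b => [GraphSymbol.bit b]) ?_ _ ?_
  · intro a b r s h
    simpa using h
  · intro a r s h
    simp at h

theorem encodeGraph_code {m n : ℕ} (G : SimpleGraph (Fin m)) (H : SimpleGraph (Fin n))
    (r s : List GraphSymbol) (h : encodeGraph G ++ r = encodeGraph H ++ s) :
    (⟨m, G⟩ : Σ k, SimpleGraph (Fin k)) = ⟨n, H⟩ ∧ r = s := by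
  have key : PrefixCode
      (fun l : List (List Bool) => l.flatMap encodeRow ++ [GraphSymbol.endGraph]) := by
    refine encodeRow_code.list _ ?_
    intro a r s h
    cases a <;> simp [encodeRow] at h
  obtain ⟨h1, h2⟩ := key _ _ r s h
  have hmn : m = n := by simpa using congrArg List.length h1
  subst hmn
  refine ⟨?_, h2⟩
  have h3 : G = H := by
    ext i j
    have h4 := List.map_inj_left.1 h1 i (List.mem_finRange i)
    have h5 := List.map_inj_left.1 h4 j (List.mem_finRange j)
    simpa using h5
  rw [h3]

theorem GraphPair.encode_injective : Function.Injective GraphPair.encode := by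
  rintro ⟨m, n, G, H⟩ ⟨m', n', G', H'⟩ h
  obtain ⟨h1, h2⟩ := encodeGraph_code G G' _ _ h
  obtain ⟨h3, -⟩ := encodeGraph_code H H' [] [] (by simpa using h2)
  cases h1
  cases h3
  rfl

/-- The graph isomorphism problem. -/
noncomputable def GI : Problem where
  Instance := GraphPair
  Alphabet := GraphSymbol
  alphabet_finite := GraphSymbol.finite
  encode := GraphPair.encode
  encode_injective := GraphPair.encode_injective
  IsYes x := Nonempty (x.G ≃g x.H)

/-! ### Boolean constraints -/

/-- A constraint of arity `k`: a Boolean function from `{0,1}^k` to `{0,1}`. -/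
structure Constraint where
  arity : ℕ
  fn : (Fin arity → Bool) → Bool

/-- A literal: the variable `v`, or its negation. -/
structure Literal (k : ℕ) where
  v : Fin k
  negated : Bool

def Literal.eval {k : ℕ} (l : Literal k) (a : Fin k → Bool) : Bool :=
  if l.negated then !(a l.v) else a l.v

/-- A clause is a list of literals; read as a disjunction, it is true if some literal is. -/
def orClause {k : ℕ} (c : List (Literal k)) (a : Fin k → Bool) : Bool :=
  c.any fun l => l.eval a

/-- A clause read as an exclusive or: it is true if an odd number of its literals is. -/
def xorClause {k : ℕ} (c : List (Literal k)) (a : Fin k → Bool) : Bool :=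
  c.foldr (fun l b => xor (l.eval a) b) false

/-- Equivalent to a 2CNF formula: a conjunction of disjunctions of at most two literals. -/
def Constraint.IsBijunctive (C : Constraint) : Prop :=
  ∃ φ : List (List (Literal C.arity)), (∀ c ∈ φ, c.length ≤ 2) ∧
    ∀ a, C.fn a = true ↔ ∀ c ∈ φ, orClause c a = true

/-- Equivalent to an XOR-CNF formula: a conjunction of exclusive ors of literals. -/
def Constraint.IsAffine (C : Constraint) : Prop :=
  ∃ φ : List (List (Literal C.arity)),
    ∀ a, C.fn a = true ↔ ∀ c ∈ φ, xorClause c a = true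

/-- A finite set of constraints is bijunctive if each of its members is. -/
def IsBijunctive (𝒞 : Finset Constraint) : Prop := ∀ C ∈ 𝒞, C.IsBijunctive

/-- A finite set of constraints is affine if each of its members is. -/
def IsAffine (𝒞 : Finset Constraint) : Prop := ∀ C ∈ 𝒞, C.IsAffine

/-! ### The isomorphism problem for constraint applications with constants -/

/-- A constraint application of `𝒞` with constants over the variables `{0, …, n - 1}`: each
argument is a variable or one of the constants `0` and `1`. -/
structure Application (𝒞 : Finset Constraint) (n : ℕ) where
  con : {C : Constraint // C ∈ 𝒞}
  arg : Fin con.1.arity → Fin n ⊕ Bool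

namespace Application

variable {𝒞 : Finset Constraint} {n : ℕ}

/-- The value of a constraint application under an assignment to the variables. -/
def eval (A : Application 𝒞 n) (I : Fin n → Bool) : Bool :=
  A.con.1.fn fun j => Sum.elim I id (A.arg j)

/-- Replace simultaneously all variables `x` by `π x`. -/
def rename (π : Equiv.Perm (Fin n)) (A : Application 𝒞 n) : Application 𝒞 n where
  con := A.con
  arg j := Sum.map π id (A.arg j)

end Application

/-- The assignment `I` satisfies every member of the set `S`. -/
def Satisfies {𝒞 : Finset Constraint} {n : ℕ} (I : Fin n → Bool)
    (S : List (Application 𝒞 n)) : Prop :=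
  ∀ A ∈ S, A.eval I = true

/-- The sets `S` and `U` are logically equivalent. -/
def Equivalent {𝒞 : Finset Constraint} {n : ℕ} (S U : List (Application 𝒞 n)) : Prop :=
  ∀ I : Fin n → Bool, Satisfies I S ↔ Satisfies I U

/-- The sets `S` and `U` are isomorphic: `π(S)` is equivalent to `U` for a permutation `π` of the
variables. -/
def Isomorphic {𝒞 : Finset Constraint} {n : ℕ} (S U : List (Application 𝒞 n)) : Prop :=
  ∃ π : Equiv.Perm (Fin n), Equivalent (S.map (Application.rename π)) U

/-- An instance: a number of variables, and two finite sets of constraint applications with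
constants over these variables, each given by a list of its elements. -/
structure SetPair (𝒞 : Finset Constraint) where
  n : ℕ
  S : List (Application 𝒞 n)
  U : List (Application 𝒞 n)

/-- Symbols for writing down the arguments of constraint applications. -/
inductive ArgSymbol : Type
  | const (b : Bool)
  | tick
  | endMark

theorem ArgSymbol.finite : Finite ArgSymbol := by
  refine Finite.of_injective
    (fun x : ArgSymbol => match x with
      | .const b => (some (some b) : Option (Option Bool))
      | .tick => some none
      | .endMark => none) ?_
  intro x y h
  cases x <;> cases y <;> simp_all

/-- Symbols for writing down sets of constraint applications: as `𝒞` is fixed and finite, each of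
its members is a symbol. -/
abbrev IsoSymbol (𝒞 : Finset Constraint) : Type := {C : Constraint // C ∈ 𝒞} ⊕ ArgSymbol

/-- A number in unary, followed by an end marker. -/
def encodeNat (𝒞 : Finset Constraint) (i : ℕ) : List (IsoSymbol 𝒞) :=
  List.replicate i (Sum.inr ArgSymbol.tick) ++ [Sum.inr ArgSymbol.endMark]

/-- An argument: the index of the variable in unary, or a constant. -/
def encodeArg (𝒞 : Finset Constraint) {n : ℕ} (x : Fin n ⊕ Bool) : List (IsoSymbol 𝒞) :=
  match x with
  | Sum.inl i => encodeNat 𝒞 i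
  | Sum.inr b => [Sum.inr (ArgSymbol.const b)]

/-- A constraint, followed by its arguments. -/
def encodeApplication {𝒞 : Finset Constraint} {n : ℕ} (A : Application 𝒞 n) :
    List (IsoSymbol 𝒞) :=
  Sum.inl A.con :: (List.finRange A.con.1.arity).flatMap fun j => encodeArg 𝒞 (A.arg j)

/-- The constraint applications one by one, followed by an end marker. -/
def encodeApplications {𝒞 : Finset Constraint} {n : ℕ} (S : List (Application 𝒞 n)) :
    List (IsoSymbol 𝒞) :=
  S.flatMap encodeApplication ++ [Sum.inr ArgSymbol.endMark]

/-- The number of variables in unary, followed by the two sets. -/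
def SetPair.encode {𝒞 : Finset Constraint} (x : SetPair 𝒞) : List (IsoSymbol 𝒞) :=
  encodeNat 𝒞 x.n ++ (encodeApplications x.S ++ encodeApplications x.U)

theorem encodeNat_code (𝒞 : Finset Constraint) : PrefixCode (encodeNat 𝒞) :=
  replicate_code (by simp)

theorem encodeArg_code (𝒞 : Finset Constraint) (n : ℕ) :
    PrefixCode (encodeArg 𝒞 : Fin n ⊕ Bool → _) := by
  rintro (i | b) (j | c) r s h
  · obtain ⟨h1, h2⟩ := encodeNat_code 𝒞 _ _ _ _ h
    exact ⟨by rw [Fin.ext h1], h2⟩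
  · rcases i with ⟨_ | i, hi⟩ <;> simp [encodeArg, encodeNat, List.replicate_succ] at h
  · rcases j with ⟨_ | j, hj⟩ <;> simp [encodeArg, encodeNat, List.replicate_succ] at h
  · simpa [encodeArg] using h

theorem encodeApplication_code (𝒞 : Finset Constraint) (n : ℕ) :
    PrefixCode (encodeApplication : Application 𝒞 n → _) := by
  rintro ⟨c, f⟩ ⟨d, g⟩ r s h
  simp only [encodeApplication, List.cons_append, List.cons.injEq, Sum.inl.injEq] at h
  obtain ⟨rfl, h⟩ := h
  obtain ⟨h1, h2⟩ := (encodeArg_code 𝒞 n).family _ f g r s h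
  have : f = g := funext fun j => h1 j (List.mem_finRange j)
  exact ⟨by rw [this], h2⟩

theorem encodeApplications_code (𝒞 : Finset Constraint) (n : ℕ) :
    PrefixCode (encodeApplications : List (Application 𝒞 n) → _) := by
  refine (encodeApplication_code 𝒞 n).list _ ?_
  intro a r s h
  simp [encodeApplication] at h

theorem SetPair.encode_injective (𝒞 : Finset Constraint) :
    Function.Injective (SetPair.encode : SetPair 𝒞 → _) := by
  rintro ⟨n, S, U⟩ ⟨n', S', U'⟩ h
  obtain ⟨h1, h2⟩ := encodeNat_code 𝒞 _ _ _ _ h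
  simp only at h1
  subst h1
  obtain ⟨h3, h4⟩ := encodeApplications_code 𝒞 n _ _ _ _ h2
  have h5 := (encodeApplications_code 𝒞 n).injective h4
  simp only at h3 h5
  rw [h3, h5]

/-- The problem `ISO_c(𝒞)`: given two sets of constraint applications of `𝒞` with constants over
the same variables, are they isomorphic? -/
def ISOc (𝒞 : Finset Constraint) : Problem where
  Instance := SetPair 𝒞
  Alphabet := IsoSymbol 𝒞
  alphabet_finite := by
    have := ArgSymbol.finite
    infer_instance
  encode := SetPair.encode
  encode_injective := SetPair.encode_injective 𝒞
  IsYes x := Isomorphic x.S x.U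

end BoolIso

/-!
The reduction rests on a parity constraint that every affine constraint `C` contains unless it is
bijunctive. As `C` is not bijunctive, some non-solution `a` agrees with solutions on any two
coordinates (`exists_pairwise_consistent`). A minimal set of coordinates on which `a` agrees with no
solution then has three elements `t 0`, `t 1`, `t 2`, and with the other coordinates of this set
fixed to their values in `a`, the solutions have a fixed parity on these three, since the sum of
three solutions is a solution. If as many coordinates as possible are fixed in this way, only four
solutions remain (`ParityFrame.eq_of_maximal`), and on them every coordinate is constant, equal to
one of the coordinates `t r`, or complementary to one. So, after inserting suitable variables and
constants, `C` says that `x + y + z = b` and that certain further variables, here called twins, are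
the complements of `x`, `y` or `z` (`exists_twinParity`). Twins cannot be avoided in general, and
which of them occur depends on `C`.

A graph is turned into a system of such constraints: every vertex has five copies of a variable,
forced to be equal by constraints that use the constant `b`, and an edge `(i, j)` gives a constraint
`x i + x j + y i j = b`. On the solutions of this system, call two variables parallel if their sum is
constant, and three variables a triangle if their sum is. A permutation of the variables that makes
two systems equivalent preserves both notions. The vertices are recovered as the parallel classes
with at least five elements (`exists_parallel_vertexVar`), and the edges as the pairs of vertices
that belong to a triangle (`exists_triangle_iff`). Variables that are not parallel, or do not form a
triangle, are told apart by explicit solutions in which one independent variable is switched on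
(`testSolution`).

The system is written by a multi-stack machine that reads the adjacency matrices bit by bit, keeps
the row, the column and the position in the input as unary counters, and executes a fixed list of
output instructions for every bit. Indices of variables are twelve times a counter plus a constant,
so that every instruction writes a constant word or a counter in unary. The machine is verified for
all lists of instructions (`Transducer.computable_of_output`).
-/

namespace BoolIso

/-! ### A parity constraint inside every affine constraint that is not bijunctive -/

/-- The sum of three Boolean vectors over the field with two elements. -/
def vadd {ι : Type*} (x y z : ι → Bool) : ι → Bool := fun i => xor (xor (x i) (y i)) (z i)

theorem xorClause_vadd {k : ℕ} (c : List (Literal k)) (x y z : Fin k → Bool) :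
    xorClause c (vadd x y z) = xor (xor (xorClause c x) (xorClause c y)) (xorClause c z) := by
  induction c with
  | nil => rfl
  | cons l c ih =>
    have hl : l.eval (vadd x y z) = xor (xor (l.eval x) (l.eval y)) (l.eval z) := by
      unfold Literal.eval vadd
      cases l.negated <;> simp
    have hc : ∀ w, xorClause (l :: c) w = xor (l.eval w) (xorClause c w) := fun _ => rfl
    rw [hc, hc, hc, hc, ih, hl]
    simp only [Bool.xor_assoc, Bool.xor_left_comm]

theorem Constraint.IsAffine.vadd_mem {C : Constraint} (h : C.IsAffine)
    {x y z : Fin C.arity → Bool} (hx : C.fn x = true) (hy : C.fn y = true) (hz : C.fn z = true) :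
    C.fn (vadd x y z) = true := by
  obtain ⟨φ, hφ⟩ := h
  rw [hφ] at hx hy hz ⊢
  intro c hc
  rw [xorClause_vadd, hx c hc, hy c hc, hz c hc]
  rfl

instance Literal.finite (k : ℕ) : Finite (Literal k) := by
  refine Finite.of_injective (fun l : Literal k => (l.v, l.negated)) ?_
  rintro ⟨v, s⟩ ⟨w, t⟩ h
  simpa using h

/-- The clauses with at most two literals that `C` implies do not define `C`; a vector `a` that
satisfies all of them without being a solution agrees with solutions on any two coordinates, since
the clause that forbids the values of `a` there is not implied. -/
theorem exists_pairwise_consistent {C : Constraint} (h : ¬ C.IsBijunctive) :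
    ∃ a, C.fn a ≠ true ∧ (∃ x, C.fn x = true) ∧
      ∀ i j, ∃ x, C.fn x = true ∧ x i = a i ∧ x j = a j := by
  classical
  have hfin : {c : List (Literal C.arity) | c.length ≤ 2 ∧
      ∀ x, C.fn x = true → orClause c x = true}.Finite :=
    (List.finite_length_le (Literal C.arity) 2).subset fun c hc => hc.1
  have hmem : ∀ c, c ∈ hfin.toFinset.toList ↔ c.length ≤ 2 ∧
      ∀ x, C.fn x = true → orClause c x = true := by
    intro c
    simp
  have h1 : ¬ ∀ a, C.fn a = true ↔ ∀ c ∈ hfin.toFinset.toList, orClause c a = true :=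
    fun h2 => h ⟨hfin.toFinset.toList, fun c hc => ((hmem c).1 hc).1, h2⟩
  push Not at h1
  obtain ⟨a, ha⟩ := h1
  have ha' : C.fn a ≠ true ∧ ∀ c ∈ hfin.toFinset.toList, orClause c a = true := by
    rcases ha with ⟨h2, c, hc, h3⟩ | h2
    · exact absurd (((hmem c).1 hc).2 a h2) h3
    · exact h2
  refine ⟨a, ha'.1, ?_, fun i j => ?_⟩
  · by_contra hno
    have := ha'.2 [] ((hmem _).2 ⟨by simp, fun x hx => absurd ⟨x, hx⟩ hno⟩)
    simp [orClause] at this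
  · by_contra hno
    have := ha'.2 [⟨i, a i⟩, ⟨j, a j⟩] ((hmem _).2 ⟨by simp, fun x hx => ?_⟩)
    · simp only [orClause, Literal.eval, List.any_cons, List.any_nil] at this
      cases hi : a i <;> cases hj : a j <;> simp [hi, hj] at this
    · by_contra h3
      refine hno ⟨x, hx, ?_⟩
      simp only [orClause, Literal.eval, List.any_cons, List.any_nil] at h3
      cases hi : a i <;> cases hj : a j <;> cases hxi : x i <;> cases hxj : x j <;>
        simp [hi, hj, hxi, hxj] at h3 ⊢

/-- `v` assigns values to three variables, the pairs `(r, false)`, and to three further variables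
`(r, true)`, their twins. The relation holds if the three variables have parity `b` and if every
twin that is singled out by `p` has the opposite value. -/
def TwinParity (b : Bool) (p : Fin 3 → Prop) (v : Fin 3 × Bool → Bool) : Prop :=
  xor (xor (v (0, false)) (v (1, false))) (v (2, false)) = b ∧
    ∀ r, p r → v (r, true) = !v (r, false)

/-- Three solutions of `C`, equal on `F` and different from the non-solution `a` in exactly one of
the coordinates `t 0`, `t 1`, `t 2` each; and no solution that is equal to them on `F` agrees with
`a` in these three coordinates. -/
structure ParityFrame (C : Constraint) (a : Fin C.arity → Bool) (t : Fin 3 → Fin C.arity)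
    (F : Finset (Fin C.arity)) (x : Fin 3 → Fin C.arity → Bool) : Prop where
  sol : ∀ r, C.fn (x r) = true
  eqOn : ∀ r, ∀ c ∈ F, x r c = x 0 c
  val : ∀ r s, x r (t s) = xor (a (t s)) (decide (r = s))
  excl : ∀ u, C.fn u = true → (∀ c ∈ F, u c = x 0 c) → ∃ s, u (t s) ≠ a (t s)

/-- A minimal set of coordinates on which `a` agrees with no solution has at least three elements;
three of them serve as `t`, the others as `F`. -/
theorem exists_parityFrame {C : Constraint} (hb : ¬ C.IsBijunctive) :
    ∃ a t F x, ParityFrame C a t F x := by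
  classical
  obtain ⟨a, ha, ⟨x₀, hx₀⟩, hpair⟩ := exists_pairwise_consistent hb
  obtain ⟨T, hT⟩ := exists_minimal_of_wellFoundedLT
    (fun T : Finset (Fin C.arity) => ¬ ∃ x, C.fn x = true ∧ ∀ c ∈ T, x c = a c)
    ⟨Finset.univ, by
      rintro ⟨x, hx, hxa⟩
      exact ha (by rwa [funext fun c => hxa c (Finset.mem_univ c)] at hx)⟩
  have hcard : 2 < T.card := by
    by_contra hle
    have hle' : T.card ≤ 2 := not_lt.1 hle
    refine hT.prop ?_
    interval_cases hn : T.card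
    · rw [Finset.card_eq_zero] at hn
      exact ⟨x₀, hx₀, by simp [hn]⟩
    · obtain ⟨i, rfl⟩ := Finset.card_eq_one.1 hn
      obtain ⟨x, hx, hi, -⟩ := hpair i i
      exact ⟨x, hx, by simpa using hi⟩
    · obtain ⟨i, j, -, rfl⟩ := Finset.card_eq_two.1 hn
      obtain ⟨x, hx, hi, hj⟩ := hpair i j
      exact ⟨x, hx, by simp [hi, hj]⟩
  obtain ⟨t0, t1, t2, h0, h1, h2, h01, h02, h12⟩ := Finset.two_lt_card_iff.1 hcard
  let t : Fin 3 → Fin C.arity := ![t0, t1, t2]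
  have htT : ∀ r, t r ∈ T := by
    intro r
    fin_cases r
    exacts [h0, h1, h2]
  have htinj : ∀ r s, t r = t s → r = s := by
    intro r s h
    fin_cases r <;> fin_cases s <;> simp_all [t] 
  have hx : ∀ r, ∃ x, C.fn x = true ∧ ∀ c ∈ T.erase (t r), x c = a c := by
    intro r
    by_contra hno
    exact (Finset.notMem_erase (t r) T) (hT.le_of_le hno (Finset.erase_subset _ _) (htT r))
  choose x hxC hxa using hx
  have hxt : ∀ r, x r (t r) ≠ a (t r) := by
    intro r h
    refine hT.prop ⟨x r, hxC r, fun c hc => ?_⟩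
    by_cases hcr : c = t r
    · rw [hcr, h]
    · exact hxa r c (Finset.mem_erase.2 ⟨hcr, hc⟩)
  have hF : ∀ r, ∀ c ∈ ((T.erase t0).erase t1).erase t2, x r c = a c := by
    intro r c hc
    simp only [Finset.mem_erase] at hc
    refine hxa r c (Finset.mem_erase.2 ⟨?_, hc.2.2.2⟩)
    fin_cases r
    exacts [hc.2.2.1, hc.2.1, hc.1]
  refine ⟨a, t, ((T.erase t0).erase t1).erase t2, x, hxC, fun r c hc => ?_, fun r s => ?_,
    fun u hu huF => ?_⟩
  · rw [hF r c hc, hF 0 c hc]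
  · by_cases hrs : r = s
    · subst hrs
      have := hxt r
      revert this
      cases x r (t r) <;> cases a (t r) <;> simp
    · rw [hxa r (t s) (Finset.mem_erase.2 ⟨fun h => hrs (htinj _ _ h).symm, htT s⟩)]
      simp [hrs]
  · by_contra hno
    push Not at hno
    refine hT.prop ⟨u, hu, fun c hc => ?_⟩
    by_cases hc2 : c = t2
    · exact hc2 ▸ hno 2
    by_cases hc1 : c = t1
    · exact hc1 ▸ hno 1
    by_cases hc0 : c = t0
    · exact hc0 ▸ hno 0
    have hcF : c ∈ ((T.erase t0).erase t1).erase t2 := by simp [*]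
    rw [huF c hcF, hF 0 c hcF]

/-- If `F` is maximal, a solution that agrees with the frame on `F` is determined by its values at
`t 0`, `t 1`, `t 2`: the difference of two such solutions that differ at `c` could be used to make
the three solutions of the frame agree at `c` as well. -/
theorem ParityFrame.eq_of_maximal {C : Constraint} (hC : C.IsAffine) {a : Fin C.arity → Bool}
    {t : Fin 3 → Fin C.arity} {F : Finset (Fin C.arity)} {x : Fin 3 → Fin C.arity → Bool}
    (h : ParityFrame C a t F x) (hmax : ∀ G y, F ⊆ G → ParityFrame C a t G y → G ⊆ F)
    {u w : Fin C.arity → Bool} (hu : C.fn u = true) (hw : C.fn w = true)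
    (hF : ∀ c ∈ F, u c = w c) (ht : ∀ s, u (t s) = w (t s)) :
    u = w := by
  classical
  funext c
  by_contra hc
  have hcF : c ∉ F := fun hcF => hc (hF c hcF)
  let y : Fin 3 → Fin C.arity → Bool := fun r => if x r c = x 0 c then x r else vadd (x r) u w
  have hy : ∀ r c', u c' = w c' → y r c' = x r c' := by
    intro r c' hc'
    by_cases hr : x r c = x 0 c <;> simp [y, hr, vadd, hc']
  have hyF : ∀ r, ∀ c' ∈ F, y r c' = x r c' := fun r c' hc' => hy r c' (hF c' hc')
  refine hcF (hmax (insert c F) y (Finset.subset_insert _ _) ⟨fun r => ?_, fun r c' hc' => ?_,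
    fun r s => ?_, fun v hv hvF => h.excl v hv fun c' hc' => ?_⟩ (Finset.mem_insert_self _ _))
  · by_cases hr : x r c = x 0 c
    · simpa [y, hr] using h.sol r
    · simpa [y, hr] using hC.vadd_mem (h.sol r) hu hw
  · rcases Finset.mem_insert.1 hc' with rfl | hc'
    · by_cases hr : x r c' = x 0 c'
      · simp [y, hr]
      · simp only [y, hr, if_false, if_true, vadd]
        revert hr hc
        cases u c' <;> cases w c' <;> cases x r c' <;> cases x 0 c' <;> simp
    · rw [hyF r c' hc', hyF 0 c' hc', h.eqOn r c' hc']
  · rw [hy r (t s) (ht s), h.val]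
  · rw [hvF c' (Finset.mem_insert_of_mem hc'), hyF 0 c' hc']

/-- The argument for a coordinate in which three Boolean vectors have the values `β`. There are three
reference coordinates, in the `r`-th of which vector `r` has the value `δ r` and the other two have
the opposite value. The argument is a constant, or the variable of a reference coordinate if that
has the same values, or its twin if that has the opposite values. -/
def frameArg (β δ : Fin 3 → Bool) : (Fin 3 × Bool) ⊕ Bool :=
  if β 1 = β 0 ∧ β 2 = β 0 then Sum.inr (β 0)
  else if β 1 = β 2 then Sum.inl (0, xor (β 0) (δ 0))
  else if β 0 = β 2 then Sum.inl (1, xor (β 1) (δ 1))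
  else Sum.inl (2, xor (β 2) (δ 2))

/-- The sum of the three vectors, or the vector selected by `w`, has the value prescribed by `w` in
every coordinate. -/
theorem frameArg_spec (β δ w : Fin 3 → Bool)
    (hw : xor (xor (w 0) (w 1)) (w 2) = xor (xor (δ 0) (δ 1)) (δ 2)) :
    Sum.elim (fun q : Fin 3 × Bool => xor q.2 (w q.1)) id (frameArg β δ) =
      if w 0 = δ 0 then if w 1 = δ 1 then xor (xor (β 0) (β 1)) (β 2) else β 0
      else if w 1 = δ 1 then β 1 else β 2 := by
  unfold frameArg
  revert hw
  generalize β 0 = b0, β 1 = b1, β 2 = b2, δ 0 = d0, δ 1 = d1, δ 2 = d2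
  cases b0 <;> cases b1 <;> cases b2 <;> simp <;> generalize w 0 = w0, w 1 = w1, w 2 = w2 <;>
    decide +revert

/-- An affine constraint that is not bijunctive turns into a parity of three variables, possibly
with some of their complements as further variables, if suitable variables and constants are
inserted for its arguments. -/
theorem exists_twinParity {C : Constraint} (hC : C.IsAffine) (hb : ¬ C.IsBijunctive) :
    ∃ (b : Bool) (p : Fin 3 → Prop) (arg : Fin C.arity → (Fin 3 × Bool) ⊕ Bool),
      ∀ v : Fin 3 × Bool → Bool,
        C.fn (fun c => Sum.elim v id (arg c)) = true ↔ TwinParity b p v := by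
  classical
  obtain ⟨a, t, F₀, x₀, h₀⟩ := exists_parityFrame hb
  obtain ⟨F, -, hF⟩ := exists_maximal_ge_of_wellFoundedGT
    (fun F => ∃ x, ParityFrame C a t F x) F₀ ⟨x₀, h₀⟩
  obtain ⟨x, h⟩ := hF.prop
  have hmax : ∀ G y, F ⊆ G → ParityFrame C a t G y → G ⊆ F :=
    fun G y hFG hy => hF.le_of_ge ⟨y, hy⟩ hFG
  let arg : Fin C.arity → (Fin 3 × Bool) ⊕ Bool :=
    fun c => frameArg (fun r => x r c) (fun r => x r (t r))
  have hargF : ∀ c ∈ F, arg c = Sum.inr (x 0 c) := by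
    intro c hc
    simp [arg, frameArg, h.eqOn 1 c hc, h.eqOn 2 c hc]
  have hargt : ∀ r, arg (t r) = Sum.inl (r, false) := by
    intro r
    simp only [arg, frameArg, h.val]
    fin_cases r <;> simp
  -- The three solutions and their sum realize all vectors of the right parity.
  have hplane : ∀ w : Fin 3 → Bool,
      xor (xor (w 0) (w 1)) (w 2) = !(xor (xor (a (t 0)) (a (t 1))) (a (t 2))) →
      ∃ y, C.fn y = true ∧
        ∀ c, y c = Sum.elim (fun q : Fin 3 × Bool => xor q.2 (w q.1)) id (arg c) := by
    intro w hw
    have hspec := fun c => frameArg_spec (fun r => x r c) (fun r => x r (t r)) w (by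
      rw [hw]
      simp [h.val])
    by_cases h0 : w 0 = x 0 (t 0) <;> by_cases h1 : w 1 = x 1 (t 1)
    · exact ⟨vadd (x 0) (x 1) (x 2), hC.vadd_mem (h.sol 0) (h.sol 1) (h.sol 2), fun c => by
        rw [hspec]
        simp [h0, h1, vadd]⟩
    · exact ⟨x 0, h.sol 0, fun c => by
        rw [hspec]
        simp [h0, h1]⟩
    · exact ⟨x 1, h.sol 1, fun c => by
        rw [hspec]
        simp [h0, h1]⟩
    · exact ⟨x 2, h.sol 2, fun c => by
        rw [hspec]
        simp [h0, h1]⟩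
  refine ⟨!(xor (xor (a (t 0)) (a (t 1))) (a (t 2))), fun r => ∃ c, arg c = Sum.inl (r, true),
    arg, fun v => ⟨fun hv => ?_, fun hv => ?_⟩⟩
  · have hpar : xor (xor (v (0, false)) (v (1, false))) (v (2, false)) =
        !(xor (xor (a (t 0)) (a (t 1))) (a (t 2))) := by
      by_contra hne
      -- With the wrong parity, adding two solutions of the frame gives a solution excluded by it.
      have hsum : ∃ y, C.fn y = true ∧ (∀ c ∈ F, y c = x 0 c) ∧ ∀ s, y (t s) = a (t s) := by
        by_cases h0 : v (0, false) = a (t 0)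
        · by_cases h1 : v (1, false) = a (t 1)
          · refine ⟨_, hv, fun c hc => by simp [hargF c hc], fun s => ?_⟩
            fin_cases s <;> simp [hargt] <;> revert h0 h1 hne <;>
              generalize v (0, false) = v0, v (1, false) = v1, v (2, false) = v2,
                a (t 0) = a0, a (t 1) = a1, a (t 2) = a2 <;> decide +revert
          · refine ⟨_, hC.vadd_mem hv (h.sol 1) (h.sol 2), fun c hc => ?_, fun s => ?_⟩
            · simp [vadd, hargF c hc, h.eqOn 1 c hc, h.eqOn 2 c hc]
            · fin_cases s <;> simp [vadd, hargt, h.val] <;> revert h0 h1 hne <;>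
                generalize v (0, false) = v0, v (1, false) = v1, v (2, false) = v2,
                  a (t 0) = a0, a (t 1) = a1, a (t 2) = a2 <;> decide +revert
        · by_cases h1 : v (1, false) = a (t 1)
          · refine ⟨_, hC.vadd_mem hv (h.sol 0) (h.sol 2), fun c hc => ?_, fun s => ?_⟩
            · simp [vadd, hargF c hc, h.eqOn 2 c hc]
            · fin_cases s <;> simp [vadd, hargt, h.val] <;> revert h0 h1 hne <;>
                generalize v (0, false) = v0, v (1, false) = v1, v (2, false) = v2,
                  a (t 0) = a0, a (t 1) = a1, a (t 2) = a2 <;> decide +revert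
          · refine ⟨_, hC.vadd_mem hv (h.sol 0) (h.sol 1), fun c hc => ?_, fun s => ?_⟩
            · simp [vadd, hargF c hc, h.eqOn 1 c hc]
            · fin_cases s <;> simp [vadd, hargt, h.val] <;> revert h0 h1 hne <;>
                generalize v (0, false) = v0, v (1, false) = v1, v (2, false) = v2,
                  a (t 0) = a0, a (t 1) = a1, a (t 2) = a2 <;> decide +revert
      obtain ⟨y, hy, hyF, hya⟩ := hsum
      obtain ⟨s, hs⟩ := h.excl y hy hyF
      exact hs (hya s)
    refine ⟨hpar, ?_⟩
    obtain ⟨y, hy, hyv⟩ := hplane (fun r => v (r, false)) hpar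
    have heq := h.eq_of_maximal hC hmax hv hy
      (fun c hc => by simp [hyv, hargF c hc]) (fun s => by simp [hyv, hargt])
    rintro r ⟨c, hc⟩
    have := congrFun heq c
    simpa [hyv, hc] using this
  · obtain ⟨y, hy, hyv⟩ := hplane (fun r => v (r, false)) hv.1
    convert hy using 2
    funext c
    rw [hyv]
    rcases hc : arg c with ⟨r, _ | _⟩ | s
    · simp
    · simpa using hv.2 r ⟨c, hc⟩
    · simp

/-! ### Graphs as systems of parity constraints -/

/-- The variables that describe a graph on `m` vertices: five copies of a variable for every vertex
and a variable for every ordered pair of vertices, each together with a twin, which is marked by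
`true` in the second component. -/
abbrev GraphVar (m : ℕ) : Type := ((Fin m × Fin 5) ⊕ (Fin m × Fin m)) × Bool

/-- The `c`-th copy of the variable of the vertex `i`, or its twin. -/
abbrev vertexVar {m : ℕ} (i : Fin m) (c : Fin 5) (s : Bool) : GraphVar m := (Sum.inl (i, c), s)

/-- The variable of the ordered pair `(i, j)`, or its twin. -/
abbrev pairVar {m : ℕ} (i j : Fin m) (s : Bool) : GraphVar m := (Sum.inr (i, j), s)

/-- Three families, indexed by the three variables of a `TwinParity` relation and their twins. -/
def roles {α : Type*} (f g h : Bool → α) (q : Fin 3 × Bool) : α := ![f, g, h] q.1 q.2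

theorem comp_roles {α β : Type*} (F : α → β) (f g h : Bool → α) :
    (fun q => F (roles f g h q)) =
      roles (fun s => F (f s)) (fun s => F (g s)) (fun s => F (h s)) := by
  funext ⟨r, s⟩
  fin_cases r <;> rfl

theorem twinParity_roles (b : Bool) (p : Fin 3 → Prop) (f g h : Bool → Bool) :
    TwinParity b p (roles f g h) ↔ xor (xor (f false) (g false)) (h false) = b ∧
      (p 0 → f true = !f false) ∧ (p 1 → g true = !g false) ∧ (p 2 → h true = !h false) := by
  simp [TwinParity, roles, Fin.forall_fin_succ]

/-- The solutions of the system that describes the graph `G`: the copies of a vertex variable are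
equal, and the variables of an edge and of its ends have parity `b`. -/
def GraphSat (b : Bool) (p : Fin 3 → Prop) {m : ℕ} (G : SimpleGraph (Fin m))
    (I : GraphVar m → Bool) : Prop :=
  ∀ i j,
    (∀ c c', TwinParity b p (roles (fun s => I (vertexVar i c s)) (fun s => I (vertexVar i c' s))
      (fun s => xor b s))) ∧
    (G.Adj i j → TwinParity b p (roles (fun s => I (vertexVar i 0 s)) (fun s => I (vertexVar j 0 s))
      (fun s => I (pairVar i j s))))

theorem graphSat_iff {b : Bool} {p : Fin 3 → Prop} {m : ℕ} {G : SimpleGraph (Fin m)}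
    {I : GraphVar m → Bool} :
    GraphSat b p G I ↔
      (∀ i c, I (vertexVar i c false) = I (vertexVar i 0 false)) ∧
      (p 0 ∨ p 1 → ∀ i c, I (vertexVar i c true) = !I (vertexVar i c false)) ∧
      ∀ i j, G.Adj i j → xor (xor (I (vertexVar i 0 false)) (I (vertexVar j 0 false)))
        (I (pairVar i j false)) = b ∧ (p 2 → I (pairVar i j true) = !I (pairVar i j false)) := by
  simp only [GraphSat, twinParity_roles]
  constructor
  · intro h
    refine ⟨fun i c => ?_, ?_, fun i j hij => ?_⟩
    · have := ((h i i).1 c 0).1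
      revert this
      cases I (vertexVar i c false) <;> cases I (vertexVar i 0 false) <;> cases b <;> simp
    · rintro (h0 | h1) i c
      · exact ((h i i).1 c c).2.1 h0
      · exact ((h i i).1 c c).2.2.1 h1
    · exact ⟨((h i j).2 hij).1, ((h i j).2 hij).2.2.2⟩
  -- For a pair of copies, the third role is played by the constant `b` and its complement.
  · rintro ⟨h1, h2, h3⟩ i j
    refine ⟨fun c c' => ⟨?_, fun h => h2 (Or.inl h) i c, fun h => h2 (Or.inr h) i c', by simp⟩,
      fun hij => ⟨(h3 i j hij).1, fun h => h2 (Or.inl h) i 0, fun h => h2 (Or.inr h) j 0,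
        (h3 i j hij).2⟩⟩
    rw [h1 i c, h1 i c']
    simp

/-- The sum of `u` and `w` is constant on the set `A` of assignments. -/
def Parallel {V : Type*} (A : Set (V → Bool)) (u w : V) : Prop :=
  ∃ e, ∀ I ∈ A, xor (I u) (I w) = e

/-- The sum of `u`, `v` and `w` is constant on the set `A` of assignments. -/
def Triangle {V : Type*} (A : Set (V → Bool)) (u v w : V) : Prop :=
  ∃ e, ∀ I ∈ A, xor (xor (I u) (I v)) (I w) = e

theorem Parallel.symm {V : Type*} {A : Set (V → Bool)} {u w : V} (h : Parallel A u w) :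
    Parallel A w u := by
  obtain ⟨e, h⟩ := h
  exact ⟨e, fun I hI => by rw [Bool.xor_comm, h I hI]⟩

theorem Parallel.trans {V : Type*} {A : Set (V → Bool)} {u v w : V} (h : Parallel A u v)
    (h' : Parallel A v w) : Parallel A u w := by
  obtain ⟨e, h⟩ := h
  obtain ⟨e', h'⟩ := h'
  refine ⟨xor e e', fun I hI => ?_⟩
  rw [← h I hI, ← h' I hI]
  cases I u <;> cases I v <;> cases I w <;> rfl

theorem Triangle.congr {V : Type*} {A : Set (V → Bool)} {u u' v v' w : V} (h : Triangle A u v w)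
    (hu : Parallel A u u') (hv : Parallel A v v') : Triangle A u' v' w := by
  obtain ⟨e, h⟩ := h
  obtain ⟨e', hu⟩ := hu
  obtain ⟨e'', hv⟩ := hv
  refine ⟨xor e (xor e' e''), fun I hI => ?_⟩
  rw [← h I hI, ← hu I hI, ← hv I hI]
  cases I u <;> cases I u' <;> cases I v <;> cases I v' <;> cases I w <;> rfl

section Support

variable {V : Type*} (b : Bool) (p : Fin 3 → Prop) {m : ℕ} (G : SimpleGraph (Fin m))
  (f : GraphVar m ↪ V)

/-- The solutions of the system of `G` if its variables are among the elements of `V`; the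
remaining elements of `V` are not restricted. -/
def graphSolutions : Set (V → Bool) := {I | GraphSat b p G (I ∘ f)}

open Classical in
/-- The independent variables on whose sum a variable of the system of `G` depends. -/
noncomputable def graphSupport : GraphVar m → Set V
  | (Sum.inl (i, c), s) =>
    if s = false ∨ p 0 ∨ p 1 then {f (vertexVar i 0 false)} else {f (vertexVar i c s)}
  | (Sum.inr (i, j), s) =>
    if G.Adj i j ∧ (s = false ∨ p 2) then {f (vertexVar i 0 false), f (vertexVar j 0 false)}
    else {f (pairVar i j s)}

/-- The support of any element of `V`; unrestricted elements are independent. -/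
noncomputable def support : V → Set V := Function.extend f (graphSupport p G f) fun w => {w}

/-- The value of the variables if all independent variables are zero. -/
def baseValue : GraphVar m → Bool
  | (Sum.inl _, s) => s
  | (Sum.inr _, s) => xor b s

open Classical in
/-- The solution in which all independent variables are zero, or all but one. -/
noncomputable def testSolution (o : Option V) (w : V) : Bool :=
  xor (Function.extend f (baseValue b) (fun _ => false) w) (decide (∃ s ∈ o, s ∈ support p G f w))

variable {b p G f}

theorem support_apply (u : GraphVar m) : support p G f (f u) = graphSupport p G f u :=
  f.injective.extend_apply _ _ u

theorem support_of_notMem {w : V} (hw : w ∉ Set.range f) : support p G f w = {w} :=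
  Function.extend_apply' _ _ _ hw

theorem testSolution_mem (o : Option V) : testSolution b p G f o ∈ graphSolutions b p G f := by
  classical
  have hf : ∀ u, testSolution b p G f o (f u) =
      xor (baseValue b u) (decide (∃ s ∈ o, s ∈ graphSupport p G f u)) := by
    intro u
    simp only [testSolution, support_apply, f.injective.extend_apply]
  simp only [graphSolutions, Set.mem_ofPred_eq, graphSat_iff, Function.comp_apply, hf]
  refine ⟨fun i c => ?_, fun h i c => ?_, fun i j hij => ⟨?_, fun h => ?_⟩⟩
  · simp [graphSupport, baseValue]
  · simp [graphSupport, baseValue, h]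
  · have hne : f (vertexVar i 0 false) ≠ f (vertexVar j 0 false) := by
      simpa using hij.ne
    rcases o with _ | s
    · simp [baseValue]
    · by_cases hi : s = f (vertexVar i 0 false)
      · subst hi
        simp [graphSupport, baseValue, hij, hij.ne]
      · by_cases hj : s = f (vertexVar j 0 false)
        · subst hj
          simp [graphSupport, baseValue, hij, hij.ne.symm]
        · simp [graphSupport, baseValue, hij, hi, hj]
  · simp [graphSupport, baseValue, h, hij]

theorem Parallel.support_eq {u w : V} (h : Parallel (graphSolutions b p G f) u w) :
    support p G f u = support p G f w := by
  obtain ⟨e, h⟩ := h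
  ext s
  have h0 := h _ (testSolution_mem none)
  have h1 := h _ (testSolution_mem (some s))
  rw [← h0] at h1
  simp only [testSolution, Option.mem_def, Option.some.injEq, exists_eq_left', reduceCtorEq,
    false_and, exists_false, decide_false, Bool.xor_false] at h1
  by_cases hu : s ∈ support p G f u <;> by_cases hw : s ∈ support p G f w <;> simp_all

theorem Triangle.mem_support {u v w : V} (h : Triangle (graphSolutions b p G f) u v w) (s : V) :
    s ∈ support p G f w ↔ ¬ (s ∈ support p G f u ↔ s ∈ support p G f v) := by
  obtain ⟨e, h⟩ := h
  have h0 := h _ (testSolution_mem none)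
  have h1 := h _ (testSolution_mem (some s))
  rw [← h0] at h1
  simp only [testSolution, Option.mem_def, Option.some.injEq, exists_eq_left', reduceCtorEq,
    false_and, exists_false, decide_false, Bool.xor_false] at h1
  by_cases hu : s ∈ support p G f u <;> by_cases hv : s ∈ support p G f v <;>
    by_cases hw : s ∈ support p G f w <;> simp_all

theorem parallel_vertexVar (i : Fin m) (c : Fin 5) :
    Parallel (graphSolutions b p G f) (f (vertexVar i c false)) (f (vertexVar i 0 false)) :=
  ⟨false, fun I hI => by simpa using (graphSat_iff.1 hI).1 i c⟩

theorem parallel_vertexVar_iff {i j : Fin m} :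
    Parallel (graphSolutions b p G f) (f (vertexVar i 0 false)) (f (vertexVar j 0 false)) ↔
      i = j := by
  constructor
  · intro h
    simpa [support_apply, graphSupport] using h.support_eq
  · rintro rfl
    exact parallel_vertexVar i 0

/-- Among the vertices, the edges are the pairs that belong to a triangle. -/
theorem exists_triangle_iff {i j : Fin m} (hne : i ≠ j) :
    (∃ w, Triangle (graphSolutions b p G f) (f (vertexVar i 0 false)) (f (vertexVar j 0 false)) w) ↔
      G.Adj i j := by
  constructor
  · rintro ⟨w, hw⟩
    have hs := hw.mem_support
    simp only [support_apply (vertexVar _ _ _), graphSupport] at hs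
    have hi : f (vertexVar i 0 false) ∈ support p G f w := by
      rw [hs]
      simp [hne]
    have hj : f (vertexVar j 0 false) ∈ support p G f w := by
      rw [hs]
      simp [hne.symm]
    by_cases hwf : w ∈ Set.range f
    · obtain ⟨⟨⟨k, c⟩ | ⟨k, l⟩, s⟩, rfl⟩ := hwf
      · rw [support_apply] at hi hj
        simp only [graphSupport] at hi hj
        split_ifs at hi hj
        · simp at hi hj
          exact absurd (hi.trans hj.symm) hne
        · simp at hi hj
          exact absurd (hi.1.1.trans hj.1.1.symm) hne
      · rw [support_apply] at hi hj
        simp only [graphSupport] at hi hj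
        split_ifs at hi hj with hkl
        · simp at hi hj
          rcases hi with rfl | rfl
          · rcases hj with rfl | rfl
            · exact absurd rfl hne
            · exact hkl.1
          · rcases hj with rfl | rfl
            · exact hkl.1.symm
            · exact absurd rfl hne
        · simp at hi
    · rw [support_of_notMem hwf] at hi hj
      simp only [Set.mem_singleton_iff] at hi hj
      exact absurd (by simpa using hi.trans hj.symm) hne
  · intro h
    exact ⟨f (pairVar i j false), b, fun I hI => ((graphSat_iff.1 hI).2.2 i j h).1⟩

/-- An independent variable other than a vertex variable is the only element with its support. -/
theorem eq_of_support_eq_singleton {w w' : V} (h : support p G f w' = {w}) :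
    (∃ k, w = f (vertexVar k 0 false)) ∨ w' = w := by
  by_cases hw : w' ∈ Set.range f
  · obtain ⟨⟨⟨k, c⟩ | ⟨k, l⟩, s⟩, rfl⟩ := hw
    · rw [support_apply] at h
      simp only [graphSupport] at h
      split_ifs at h
      · exact Or.inl ⟨k, (Set.singleton_eq_singleton_iff.1 h).symm⟩
      · exact Or.inr (Set.singleton_eq_singleton_iff.1 h)
    · rw [support_apply] at h
      simp only [graphSupport] at h
      split_ifs at h
      · have hk : f (vertexVar k 0 false) ∈ ({w} : Set V) := h ▸ Set.mem_insert _ _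
        exact Or.inl ⟨k, hk.symm⟩
      · exact Or.inr (Set.singleton_eq_singleton_iff.1 h)
  · rw [support_of_notMem hw] at h
    exact Or.inr (Set.singleton_eq_singleton_iff.1 h)

theorem eq_pairVar_of_support_eq {i j : Fin m} (hij : i ≠ j) {w : V}
    (h : support p G f w = {f (vertexVar i 0 false), f (vertexVar j 0 false)}) :
    ∃ s, w = f (pairVar i j s) ∨ w = f (pairVar j i s) := by
  have hi : f (vertexVar i 0 false) ∈ support p G f w := by simp [h]
  have hj : f (vertexVar j 0 false) ∈ support p G f w := by simp [h]
  have hsing : ∀ w', support p G f w ≠ {w'} := by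
    intro w' hw'
    rw [hw', Set.mem_singleton_iff] at hi hj
    exact hij (by simpa using hi.trans hj.symm)
  by_cases hw : w ∈ Set.range f
  · obtain ⟨⟨⟨k, c⟩ | ⟨k, l⟩, s⟩, rfl⟩ := hw
    · rw [support_apply] at hsing
      simp only [graphSupport] at hsing
      split_ifs at hsing <;> exact absurd rfl (hsing _)
    · rw [support_apply] at hsing hi hj
      simp only [graphSupport] at hsing hi hj
      split_ifs at hsing hi hj
      · simp at hi hj
        refine ⟨s, ?_⟩
        rcases hi with rfl | rfl <;> rcases hj with rfl | rfl <;> simp_all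
      · exact absurd rfl (hsing _)
  · exact absurd (support_of_notMem hw) (hsing _)

/-- Five elements are parallel to every vertex variable, but at most four to a variable of a pair
and at most one to any other variable that is not parallel to a vertex variable. -/
theorem exists_parallel_vertexVar {w : V}
    (h : ∃ t : Fin 5 ↪ V, ∀ c, Parallel (graphSolutions b p G f) w (t c)) :
    ∃ k, Parallel (graphSolutions b p G f) w (f (vertexVar k 0 false)) := by
  classical
  obtain ⟨t, ht⟩ := h
  have key : ∀ s : Finset V, s.card ≤ 4 → ∃ c, t c ∉ s := by
    intro s hs
    by_contra hno
    push Not at hno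
    have := Finset.card_le_card_of_injOn (s := Finset.univ) t (fun c _ => hno c)
      t.injective.injOn
    simp at this
    omega
  have hsupp := fun c => (ht c).support_eq
  have hfree : support p G f w = {w} →
      ∃ k, Parallel (graphSolutions b p G f) w (f (vertexVar k 0 false)) := by
    intro hw
    obtain ⟨c, hc⟩ := key {w} (by simp)
    rcases eq_of_support_eq_singleton ((hsupp c).symm.trans hw) with ⟨k, rfl⟩ | h
    · exact ⟨k, parallel_vertexVar k 0⟩
    · exact absurd (Finset.mem_singleton.2 h) hc
  by_cases hwf : w ∈ Set.range f
  · obtain ⟨⟨⟨k, c⟩ | ⟨i, j⟩, s⟩, rfl⟩ := hwf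
    · by_cases hs : s = false ∨ p 0 ∨ p 1
      · refine ⟨k, Parallel.trans ?_ (parallel_vertexVar k c)⟩
        refine ⟨s, fun I hI => ?_⟩
        rcases s with _ | _
        · simp
        · have := (graphSat_iff.1 hI).2.1 (hs.resolve_left (by simp)) k c
          simp only [Function.comp_apply] at this
          simp [this]
      · exact hfree (by simp only [support_apply, graphSupport, if_neg hs])
    · by_cases hs : G.Adj i j ∧ (s = false ∨ p 2)
      · obtain ⟨c, hc⟩ := key {f (pairVar i j false), f (pairVar i j true), f (pairVar j i false),
          f (pairVar j i true)} Finset.card_le_four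
        have hcs := (hsupp c).symm
        simp only [support_apply, graphSupport, if_pos hs] at hcs
        obtain ⟨s', h | h⟩ := eq_pairVar_of_support_eq hs.1.ne hcs <;>
          cases s' <;> simp [h] at hc
      · exact hfree (by simp only [support_apply, graphSupport, if_neg hs])
  · exact hfree (support_of_notMem hwf)

end Support

theorem Parallel.map {V : Type*} {A B : Set (V → Bool)} {π : Equiv.Perm V}
    (h : ∀ I ∈ B, I ∘ π ∈ A) {u w : V} (huw : Parallel A u w) : Parallel B (π u) (π w) := by
  obtain ⟨e, he⟩ := huw
  exact ⟨e, fun I hI => he _ (h I hI)⟩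

theorem Triangle.map {V : Type*} {A B : Set (V → Bool)} {π : Equiv.Perm V}
    (h : ∀ I ∈ B, I ∘ π ∈ A) {u v w : V} (ht : Triangle A u v w) :
    Triangle B (π u) (π v) (π w) := by
  obtain ⟨e, he⟩ := ht
  exact ⟨e, fun I hI => he _ (h I hI)⟩

/-- A permutation that turns the system of `G` into that of `H` maps vertex variables to elements
that are parallel to vertex variables, and thus induces a map of the vertices. -/
theorem exists_vertex_map {V : Type*} {b : Bool} {p : Fin 3 → Prop} {m n : ℕ}
    {G : SimpleGraph (Fin m)} {H : SimpleGraph (Fin n)} {f : GraphVar m ↪ V} {g : GraphVar n ↪ V}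
    (π : Equiv.Perm V)
    (h : ∀ I : V → Bool, I ∘ π ∈ graphSolutions b p G f ↔ I ∈ graphSolutions b p H g) :
    ∃ σ : Fin m → Fin n, Function.Injective σ ∧ ∀ i j, G.Adj i j ↔ H.Adj (σ i) (σ j) := by
  have h' : ∀ I ∈ graphSolutions b p G f, I ∘ π.symm ∈ graphSolutions b p H g := by
    intro I hI
    rw [← h]
    convert hI
    funext v
    simp
  have h := fun I => (h I).2
  have hσ : ∀ i, ∃ k, Parallel (graphSolutions b p H g) (π (f (vertexVar i 0 false)))
      (g (vertexVar k 0 false)) := by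
    intro i
    refine exists_parallel_vertexVar
      ⟨⟨fun c => π (f (vertexVar i c false)), fun c c' hc => by simpa using hc⟩, fun c => ?_⟩
    exact ((parallel_vertexVar i c).map h).symm
  choose σ hσ using hσ
  have hinj : Function.Injective σ := by
    intro i j hij
    have hpar := (hσ i).trans (hij ▸ (hσ j).symm)
    have := hpar.map (π := π.symm) h'
    simp only [Equiv.symm_apply_apply] at this
    exact parallel_vertexVar_iff.1 this
  refine ⟨σ, hinj, fun i j => ?_⟩
  by_cases hij : i = j
  · subst hij
    simp
  rw [← exists_triangle_iff (b := b) (p := p) (f := f) hij,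
    ← exists_triangle_iff (b := b) (p := p) (f := g) (hinj.ne hij)]
  constructor
  · rintro ⟨w, hw⟩
    exact ⟨π w, (hw.map h).congr (hσ i) (hσ j)⟩
  · rintro ⟨w, hw⟩
    refine ⟨π.symm w, ?_⟩
    simpa using (hw.congr (hσ i).symm (hσ j).symm).map (π := π.symm) h'

/-- An equivalence of two such systems after a permutation of the elements of `V` comes from an
isomorphism of the graphs. -/
theorem nonempty_iso_of_perm {V : Type*} {b : Bool} {p : Fin 3 → Prop} {m n : ℕ}
    {G : SimpleGraph (Fin m)} {H : SimpleGraph (Fin n)} {f : GraphVar m ↪ V} {g : GraphVar n ↪ V}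
    (π : Equiv.Perm V)
    (h : ∀ I : V → Bool, I ∘ π ∈ graphSolutions b p G f ↔ I ∈ graphSolutions b p H g) :
    Nonempty (G ≃g H) := by
  obtain ⟨σ, hσ, hadj⟩ := exists_vertex_map π h
  obtain ⟨τ, hτ, -⟩ := exists_vertex_map (G := H) (H := G) (f := g) (g := f) (b := b) (p := p)
    π.symm fun I => by
      rw [← h]
      simp [Function.comp_assoc]
  have hmn : m = n := le_antisymm (by simpa using Fintype.card_le_of_injective σ hσ)
    (by simpa using Fintype.card_le_of_injective τ hτ)
  have hbij : Function.Bijective σ := by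
    rw [Fintype.bijective_iff_injective_and_card]
    exact ⟨hσ, by simp [hmn]⟩
  exact ⟨⟨Equiv.ofBijective σ hbij, by simp [hadj]⟩⟩

/-- The bijection of the variables induced by an isomorphism extends to a permutation of `V`. -/
theorem exists_perm_of_iso {V : Type*} [Finite V] {b : Bool} {p : Fin 3 → Prop} {m n : ℕ}
    {G : SimpleGraph (Fin m)} {H : SimpleGraph (Fin n)} (f : GraphVar m ↪ V) (g : GraphVar n ↪ V)
    (σ : G ≃g H) :
    ∃ π : Equiv.Perm V,
      ∀ I : V → Bool, I ∘ π ∈ graphSolutions b p G f ↔ I ∈ graphSolutions b p H g := by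
  classical
  have := Fintype.ofFinite V
  let τ : GraphVar m ≃ GraphVar n :=
    ((σ.toEquiv.prodCongr (Equiv.refl _)).sumCongr (σ.toEquiv.prodCongr σ.toEquiv)).prodCongr
      (Equiv.refl _)
  let e : {v // v ∈ Set.range f} ≃ {v // v ∈ Set.range g} :=
    (Equiv.ofInjective f f.injective).symm.trans (τ.trans (Equiv.ofInjective g g.injective))
  have he : ∀ u, e.extendSubtype (f u) = g (τ u) := by
    intro u
    rw [e.extendSubtype_apply_of_mem _ ⟨u, rfl⟩]
    have : (⟨f u, ⟨u, rfl⟩⟩ : {v // v ∈ Set.range f}) = Equiv.ofInjective f f.injective u := rfl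
    rw [this]
    simp [e]
  refine ⟨e.extendSubtype, fun I => ?_⟩
  have hI : (I ∘ e.extendSubtype) ∘ f = fun u => (I ∘ g) (τ u) := by
    funext u
    simp [he]
  simp only [graphSolutions, Set.mem_ofPred_eq, hI, GraphSat]
  have hτ : ∀ i c s, τ (vertexVar i c s) = vertexVar (σ i) c s := fun _ _ _ => rfl
  have hτ' : ∀ i j s, τ (pairVar i j s) = pairVar (σ i) (σ j) s := fun _ _ _ => rfl
  simp only [hτ, hτ', ← σ.map_adj_iff]
  constructor
  · intro h i j
    simpa using h (σ.symm i) (σ.symm j)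
  · intro h i j
    exact h (σ i) (σ j)

/-! ### A Turing machine for graph transducers -/

/-- The counters of the transducer: the row and the column in the current adjacency matrix, and the
position in the input word. -/
inductive Counter : Type
  | row
  | col
  | pos
  deriving DecidableEq

instance : Fintype Counter where
  elems := {.row, .col, .pos}
  complete := by rintro (_ | _ | _) <;> decide

/-- An instruction of the transducer: write a symbol, or write a counter in unary. -/
inductive Instr (Ω : Type) : Type
  | emit (a : Ω)
  | unary (q : Counter)

/-- The values of the three counters. -/
def counts (i j p : ℕ) : Counter → ℕ
  | .row => i
  | .col => j
  | .pos => p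

/-- A transducer that reads the adjacency matrices of graphs bit by bit and executes for every bit
a list of instructions that depends on the bit only. In unary numbers, every unit of a counter is
written as `width` ticks. -/
structure Transducer (Ω : Type) where
  tick : Ω
  endMark : Ω
  width : ℕ
  prog : Bool → List (Instr Ω)

namespace Transducer

variable {Ω : Type} (D : Transducer Ω)

/-- The word written by an instruction. -/
def instrOutput (c : Counter → ℕ) : Instr Ω → List Ω
  | .emit a => [a]
  | .unary q => List.replicate (D.width * c q) D.tick

/-- The word that is written while a word is read, starting in row `i`, column `j` and
position `p`. -/
def transduce : List GraphSymbol → ℕ → ℕ → ℕ → List Ω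
  | [], _, _, _ => []
  | .bit b :: w, i, j, p =>
    (D.prog b).flatMap (D.instrOutput (counts i j p)) ++ transduce w i (j + 1) (p + 1)
  | .endRow :: w, i, _, p => transduce w (i + 1) 0 (p + 1)
  | .endGraph :: w, _, j, p => D.endMark :: transduce w 0 j (p + 1)

/-- The output of the transducer: the length of the input in unary, times the width, an end mark,
and the words written while the input is read. -/
def output (w : List GraphSymbol) : List Ω :=
  List.replicate (D.width * w.length) D.tick ++ D.endMark :: D.transduce w 0 0 0

end Transducer

/-- The stacks of the machine: the input, the output, the output in reverse order, a scratch
counter, and the counters. -/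
inductive Stack : Type
  | inp
  | out
  | rev
  | tmp
  | counter (q : Counter)
  deriving DecidableEq, Fintype

/-- The stack symbols; counters are in unary. -/
abbrev StackAlphabet (Ω : Type) : Stack → Type
  | .inp => GraphSymbol
  | .out => Ω
  | .rev => Ω
  | .tmp => Unit
  | .counter _ => Unit

/-- The labels of the machine, where `S` is the type of the lists of instructions that may be left
to execute. -/
inductive Label (S : Type) : Type
  | read
  | run (l : S)
  | up (q : Counter) (l : S)
  | down (q : Counter) (l : S)
  | nextRow
  | nextGraph
  | clear (q : Counter) (final : Bool)
  | flush
  | count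
  deriving Fintype

/-- The result of the last pop: no symbol, an input symbol, an output symbol, or a unit of a
counter. -/
abbrev Memory (Ω : Type) : Type := Option (GraphSymbol ⊕ Option Ω)

/-- The contents of the stacks. -/
def contents {Ω : Type} (inp : List GraphSymbol) (out rev : List Ω) (tmp : ℕ) (c : Counter → ℕ) :
    ∀ k, List (StackAlphabet Ω k)
  | .inp => inp
  | .out => out
  | .rev => rev
  | .tmp => List.replicate tmp ()
  | .counter q => List.replicate (c q) ()

section Stacks

variable {Ω : Type} (inp : List GraphSymbol) (out rev : List Ω) (tmp : ℕ) (c : Counter → ℕ)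

theorem contents_inp : contents inp out rev tmp c .inp = inp := rfl

theorem contents_out : contents inp out rev tmp c .out = out := rfl

theorem contents_rev : contents inp out rev tmp c .rev = rev := rfl

theorem contents_tmp : contents inp out rev tmp c .tmp = List.replicate tmp () := rfl

theorem contents_counter (q : Counter) :
    contents inp out rev tmp c (.counter q) = List.replicate (c q) () := rfl

theorem update_contents_inp (w : List GraphSymbol) :
    Function.update (contents inp out rev tmp c) .inp w = contents w out rev tmp c := by
  funext k
  cases k <;> rfl

theorem update_contents_out (w : List Ω) :
    Function.update (contents inp out rev tmp c) .out w = contents inp w rev tmp c := by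
  funext k
  cases k <;> rfl

theorem update_contents_rev (w : List Ω) :
    Function.update (contents inp out rev tmp c) .rev w = contents inp out w tmp c := by
  funext k
  cases k <;> rfl

theorem update_contents_tmp (w : List Unit) :
    Function.update (contents inp out rev tmp c) .tmp w = contents inp out rev w.length c := by
  funext k
  cases k
  case tmp => exact List.eq_replicate_iff.2 ⟨rfl, fun _ _ => rfl⟩
  all_goals rfl

theorem update_contents_counter (q : Counter) (w : List Unit) :
    Function.update (contents inp out rev tmp c) (.counter q) w =
      contents inp out rev tmp (Function.update c q w.length) := by
  funext k
  cases k
  case counter q' =>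
    by_cases h : q' = q
    · subst h
      simp only [Function.update_self, contents]
      exact List.eq_replicate_iff.2 ⟨rfl, fun _ _ => rfl⟩
    · rw [Function.update_of_ne (by simpa using h)]
      simp [contents, Function.update_of_ne h]
  all_goals rfl

end Stacks

namespace Transducer

open Turing Turing.TM2.Stmt

variable {Ω : Type} (D : Transducer Ω)

/-- The lists of instructions that may be left to execute: the suffixes of the two programs. -/
def Rest : Type := {l : List (Instr Ω) // l <:+ D.prog false ∨ l <:+ D.prog true}

instance : Finite D.Rest := by
  classical
  refine Set.Finite.to_subtype (s := fun l => l <:+ D.prog false ∨ l <:+ D.prog true)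
    (((D.prog false).tails ++ (D.prog true).tails).toFinset.finite_toSet.subset fun l hl => ?_)
  rcases hl with hl | hl <;> simp [hl]

variable {D} in
/-- What is left after the first instruction. -/
def Rest.tail {a : Instr Ω} {l : List (Instr Ω)}
    (h : a :: l <:+ D.prog false ∨ a :: l <:+ D.prog true) : D.Rest :=
  ⟨l, h.imp (List.suffix_cons a l).trans (List.suffix_cons a l).trans⟩

/-- The whole program for the bit `b`. -/
def start (b : Bool) : D.Rest :=
  ⟨D.prog b, by cases b <;> simp⟩

/-- The statements of the machine. -/
abbrev Stmt : Type := TM2.Stmt (StackAlphabet Ω) (Label D.Rest) (Memory Ω)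

/-- Push a symbol `n` times. -/
def pushN (k : Stack) (a : StackAlphabet Ω k) : ℕ → D.Stmt → D.Stmt
  | 0, q => q
  | n + 1, q => push k (fun _ => a) (pushN k a n q)

/-- Pop a unit of a counter and continue depending on whether there was one. -/
def popUnit (q : Counter) (yes no : D.Stmt) : D.Stmt :=
  pop (.counter q) (fun _ o => o.map fun _ => Sum.inr none) (branch Option.isSome yes no)

/-- The label after reading an input symbol. -/
def afterRead : Memory Ω → Label D.Rest
  | some (Sum.inl (.bit b)) => .run (D.start b)
  | some (Sum.inl .endRow) => .nextRow
  | some (Sum.inl .endGraph) => .nextGraph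
  | _ => .clear .row true

/-- The label after clearing a counter. -/
def afterClear : Counter → Bool → Label D.Rest
  | _, false => .read
  | .row, true => .clear .col true
  | _, true => .flush

/-- The output symbol in memory. -/
def symbol : Memory Ω → Ω
  | some (Sum.inr (some a)) => a
  | _ => D.endMark

/-- The code of the machine. The labels `up` and `down` move a counter to the scratch counter,
writing ticks, and back; `flush` reverses what has been written, and `count` puts the number of
input symbols in front of it. -/
def code : Label D.Rest → D.Stmt
  | .read => pop .inp (fun _ o => o.map Sum.inl) (goto D.afterRead)
  | .run ⟨[], _⟩ =>
    push (.counter .col) (fun _ => ()) (push (.counter .pos) (fun _ => ()) (goto fun _ => .read))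
  | .run ⟨.emit a :: _, h⟩ => push .rev (fun _ => a) (goto fun _ => .run (Rest.tail h))
  | .run ⟨.unary q :: _, h⟩ => goto fun _ => .up q (Rest.tail h)
  | .up q l =>
    D.popUnit q (push .tmp (fun _ => ()) (D.pushN .rev D.tick D.width (goto fun _ => .up q l)))
      (goto fun _ => .down q l)
  | .down q l =>
    pop .tmp (fun _ o => o.map fun _ => Sum.inr none)
      (branch Option.isSome (push (.counter q) (fun _ => ()) (goto fun _ => .down q l))
        (goto fun _ => .run l))
  | .nextRow =>
    push (.counter .row) (fun _ => ()) (push (.counter .pos) (fun _ => ())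
      (goto fun _ => .clear .col false))
  | .nextGraph =>
    push (.counter .pos) (fun _ => ()) (push .rev (fun _ => D.endMark)
      (goto fun _ => .clear .row false))
  | .clear q final => D.popUnit q (goto fun _ => .clear q final) (goto fun _ => D.afterClear q final)
  | .flush =>
    pop .rev (fun _ o => o.map fun a => Sum.inr (some a))
      (branch Option.isSome (push .out D.symbol (goto fun _ => .flush))
        (push .out (fun _ => D.endMark) (goto fun _ => .count)))
  | .count =>
    D.popUnit .pos (D.pushN .out D.tick D.width (goto fun _ => .count)) (load (fun _ => none) halt)

theorem stepAux_pushN (k : Stack) (a : StackAlphabet Ω k) (n : ℕ) (q : D.Stmt) (v : Memory Ω)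
    (S : ∀ k, List (StackAlphabet Ω k)) :
    TM2.stepAux (D.pushN k a n q) v S =
      TM2.stepAux q v (Function.update S k (List.replicate n a ++ S k)) := by
  induction n generalizing S with
  | zero => simp [pushN]
  | succ n ih =>
    simp only [pushN, TM2.stepAux, ih, Function.update_self, Function.update_idem]
    rw [List.replicate_succ', List.append_assoc]
    rfl

/-- In at most `T` steps, the machine gets from the first label and stacks to the second ones,
whatever is in its memory. -/
def Reach (T : ℕ) (l : Label D.Rest) (S : ∀ k, List (StackAlphabet Ω k)) (l' : Label D.Rest)
    (S' : ∀ k, List (StackAlphabet Ω k)) : Prop :=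
  ∀ v, ∃ v', Nonempty (StateTransition.EvalsToInTime (TM2.step D.code) ⟨some l, v, S⟩
    (some ⟨some l', v', S'⟩) T)

variable {D}

theorem Reach.refl (l : Label D.Rest) (S : ∀ k, List (StackAlphabet Ω k)) : D.Reach 0 l S l S :=
  fun v => ⟨v, ⟨StateTransition.EvalsToInTime.refl _ _⟩⟩

theorem Reach.trans {T T' : ℕ} {l l' l'' : Label D.Rest}
    {S S' S'' : ∀ k, List (StackAlphabet Ω k)} (h : D.Reach T l S l' S')
    (h' : D.Reach T' l' S' l'' S'') : D.Reach (T + T') l S l'' S'' := by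
  intro v
  obtain ⟨v', ⟨h1⟩⟩ := h v
  obtain ⟨v'', ⟨h2⟩⟩ := h' v'
  exact ⟨v'', ⟨add_comm T T' ▸ h1.trans _ _ _ _ _ _ h2⟩⟩

theorem Reach.mono {T T' : ℕ} {l l' : Label D.Rest} {S S' : ∀ k, List (StackAlphabet Ω k)}
    (h : D.Reach T l S l' S') (hT : T ≤ T') : D.Reach T' l S l' S' := by
  intro v
  obtain ⟨v', ⟨h1⟩⟩ := h v
  exact ⟨v', ⟨⟨h1.toEvalsTo, h1.steps_le_m.trans hT⟩⟩⟩

theorem Reach.single {l l' : Label D.Rest} {S S' : ∀ k, List (StackAlphabet Ω k)}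
    (h : ∀ v, ∃ v', TM2.stepAux (D.code l) v S = ⟨some l', v', S'⟩) : D.Reach 1 l S l' S' := by
  intro v
  obtain ⟨v', hv⟩ := h v
  refine ⟨v', ⟨⟨⟨1, ?_⟩, le_rfl⟩⟩⟩
  rw [← hv]
  rfl

variable (inp : List GraphSymbol) (out rev : List Ω) (tmp : ℕ) (c : Counter → ℕ)

/-- Writing a counter in unary moves it to the scratch counter. -/
theorem reach_up (q : Counter) (l : D.Rest) :
    D.Reach (c q + 1) (.up q l) (contents inp out rev tmp c) (.down q l)
      (contents inp out (List.replicate (D.width * c q) D.tick ++ rev) (tmp + c q)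
        (Function.update c q 0)) := by
  generalize hn : c q = n
  induction n generalizing rev tmp c with
  | zero =>
    refine Reach.single fun v => ⟨none, ?_⟩
    simp [code, popUnit, contents_counter, hn, update_contents_counter]
  | succ n ih =>
    rw [add_comm (n + 1) 1]
    refine Reach.trans (l' := .up q l) (S' := contents inp out
      (List.replicate D.width D.tick ++ rev) (tmp + 1) (Function.update c q n))
      (Reach.single fun v => ⟨some (Sum.inr none), ?_⟩) ?_
    · simp [code, popUnit, contents_counter, contents_tmp, contents_rev, hn, update_contents_counter,
        update_contents_tmp, update_contents_rev, stepAux_pushN, List.replicate_succ]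
    · have := ih (List.replicate D.width D.tick ++ rev) (tmp + 1) (Function.update c q n) (by simp)
      rw [Function.update_idem, ← List.append_assoc, List.replicate_append_replicate] at this
      rw [mul_add, mul_one, add_comm n 1, ← add_assoc, add_comm 1 n]
      exact this

theorem reach_down (q : Counter) (l : D.Rest) :
    D.Reach (tmp + 1) (.down q l) (contents inp out rev tmp c) (.run l)
      (contents inp out rev 0 (Function.update c q (c q + tmp))) := by
  induction tmp generalizing c with
  | zero =>
    refine Reach.single fun v => ⟨none, ?_⟩
    simp [code, contents_tmp, update_contents_tmp]
  | succ n ih =>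
    rw [add_comm (n + 1) 1]
    refine Reach.trans (l' := .down q l) (S' := contents inp out rev n
      (Function.update c q (c q + 1))) (Reach.single fun v => ⟨some (Sum.inr none), ?_⟩) ?_
    · simp [code, contents_tmp, contents_counter, update_contents_tmp, update_contents_counter,
        List.replicate_succ]
    · have := ih (Function.update c q (c q + 1))
      rw [Function.update_idem, Function.update_self, add_assoc, add_comm 1 n] at this
      exact this

theorem reach_clear (q : Counter) (final : Bool) :
    D.Reach (c q + 1) (.clear q final) (contents inp out rev tmp c) (D.afterClear q final)
      (contents inp out rev tmp (Function.update c q 0)) := by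
  generalize hn : c q = n
  induction n generalizing c with
  | zero =>
    refine Reach.single fun v => ⟨none, ?_⟩
    simp [code, popUnit, contents_counter, hn, update_contents_counter]
  | succ n ih =>
    rw [add_comm (n + 1) 1]
    refine Reach.trans (l' := .clear q final) (S' := contents inp out rev tmp
      (Function.update c q n)) (Reach.single fun v => ⟨some (Sum.inr none), ?_⟩) ?_
    · simp [code, popUnit, contents_counter, hn, update_contents_counter, List.replicate_succ]
    · have := ih (Function.update c q n) (by simp)
      rwa [Function.update_idem] at this

theorem reach_flush :
    D.Reach (rev.length + 1) .flush (contents inp out rev tmp c) .count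
      (contents inp (D.endMark :: (rev.reverse ++ out)) [] tmp c) := by
  induction rev generalizing out with
  | nil =>
    refine Reach.single fun v => ⟨none, ?_⟩
    simp [code, contents_rev, contents_out, update_contents_out, update_contents_rev]
  | cons a rev ih =>
    rw [List.length_cons, add_comm (rev.length + 1) 1]
    refine Reach.trans (l' := .flush) (S' := contents inp (a :: out) rev tmp c)
      (Reach.single fun v => ⟨some (Sum.inr (some a)), ?_⟩) ?_
    · simp [code, symbol, contents_rev, contents_out, update_contents_out, update_contents_rev]
    · simpa using ih (a :: out)

/-- The final phase, which halts with empty memory; `Reach` covers only configurations that have a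
label. -/
theorem evalsTo_count (v : Memory Ω) :
    Nonempty (StateTransition.EvalsToInTime (TM2.step D.code)
      ⟨some .count, v, contents inp out rev tmp c⟩
      (some ⟨none, none, contents inp (List.replicate (D.width * c .pos) D.tick ++ out) rev tmp
        (Function.update c .pos 0)⟩) (c .pos + 1)) := by
  generalize hn : c .pos = n
  induction n generalizing out c v with
  | zero =>
    refine ⟨⟨⟨1, ?_⟩, le_rfl⟩⟩
    simp [flip, code, popUnit, contents_counter, hn, update_contents_counter]
  | succ n ih =>
    obtain ⟨h2⟩ := ih (List.replicate D.width D.tick ++ out) (Function.update c .pos n)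
      (some (Sum.inr none)) (by simp)
    rw [Function.update_idem, ← List.append_assoc, List.replicate_append_replicate] at h2
    have h1 : StateTransition.EvalsToInTime (TM2.step D.code)
        ⟨some .count, v, contents inp out rev tmp c⟩
        (some ⟨some .count, some (Sum.inr none), contents inp (List.replicate D.width D.tick ++ out)
          rev tmp (Function.update c .pos n)⟩) 1 := by
      refine ⟨⟨1, ?_⟩, le_rfl⟩
      simp [flip, code, popUnit, contents_counter, contents_out, hn, update_contents_counter,
        update_contents_out, stepAux_pushN, List.replicate_succ]
    rw [mul_add, mul_one]
    exact ⟨h1.trans _ _ _ _ _ _ h2⟩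

theorem reach_run (L : ℕ) (i j p : ℕ) (hc : ∀ q, counts i j p q ≤ L) (l : D.Rest) :
    D.Reach (l.1.length * (2 * L + 3) + 1) (.run l) (contents inp out rev 0 (counts i j p)) .read
      (contents inp out ((l.1.flatMap (D.instrOutput (counts i j p))).reverse ++ rev) 0
        (counts i (j + 1) (p + 1))) := by
  obtain ⟨l, hl⟩ := l
  induction l generalizing rev with
  | nil =>
    refine (Reach.single fun v => ⟨v, ?_⟩).mono (by simp)
    simp only [code, TM2.stepAux, contents_counter, update_contents_counter]
    congr 2
    funext q
    cases q <;> simp [counts]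
  | cons a l ih =>
    have h2 := fun rev' => ih rev' (Rest.tail hl).2
    rcases a with a | q
    · have h1 : D.Reach 1 (.run ⟨.emit a :: l, hl⟩) (contents inp out rev 0 (counts i j p))
          (.run (Rest.tail hl)) (contents inp out (a :: rev) 0 (counts i j p)) :=
        Reach.single fun v => ⟨v, by simp [code, contents_rev, update_contents_rev]⟩
      have := (h1.trans (h2 (a :: rev))).mono
        (T' := (Instr.emit a :: l).length * (2 * L + 3) + 1) (by
          simp only [List.length_cons]
          nlinarith)
      simpa [instrOutput, Rest.tail] using this
    · have h1 : D.Reach 1 (.run ⟨.unary q :: l, hl⟩) (contents inp out rev 0 (counts i j p))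
          (.up q (Rest.tail hl)) (contents inp out rev 0 (counts i j p)) :=
        Reach.single fun v => ⟨v, by simp [code]⟩
      have h3 := reach_up inp out rev 0 (counts i j p) q (Rest.tail hl)
      have h4 := reach_down inp out
        (List.replicate (D.width * counts i j p q) D.tick ++ rev) (0 + counts i j p q)
        (Function.update (counts i j p) q 0) q (Rest.tail hl)
      have hback : Function.update (Function.update (counts i j p) q 0) q
          ((Function.update (counts i j p) q 0) q + (0 + counts i j p q)) = counts i j p := by
        simp
      rw [hback] at h4
      have := ((h1.trans (h3.trans h4)).trans (h2 _)).mono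
        (T' := (Instr.unary q :: l).length * (2 * L + 3) + 1) (by
          have := hc q
          simp only [List.length_cons]
          nlinarith)
      simpa [instrOutput, Rest.tail] using this

/-- While the input is read, the counters are bounded by its length `L`, hence so is the time for
writing one of them. -/
theorem reach_read (L : ℕ) (w : List GraphSymbol) (i j p : ℕ) (hi : i + w.length ≤ L)
    (hj : j + w.length ≤ L) (hp : p + w.length ≤ L) :
    ∃ i' j', i' ≤ L ∧ j' ≤ L ∧
      D.Reach (w.length * (((D.prog false).length + (D.prog true).length + 1) * (2 * L + 3) + 2))
        .read (contents w out rev 0 (counts i j p)) .read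
        (contents [] out ((D.transduce w i j p).reverse ++ rev) 0 (counts i' j' (p + w.length))) := by
  induction w generalizing i j p rev with
  | nil => exact ⟨i, j, by simpa using hi, by simpa using hj, by simpa [transduce] using Reach.refl _ _⟩
  | cons a w ih =>
    have hread : D.Reach 1 .read (contents (a :: w) out rev 0 (counts i j p))
        (D.afterRead (some (Sum.inl a))) (contents w out rev 0 (counts i j p)) :=
      Reach.single fun v => ⟨some (Sum.inl a), by simp [code, contents_inp, update_contents_inp]⟩
    simp only [List.length_cons] at hi hj hp ⊢
    rcases a with b | _ | _
    · obtain ⟨i', j', hi', hj', h⟩ := ih (((D.prog b).flatMap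
        (D.instrOutput (counts i j p))).reverse ++ rev) i (j + 1) (p + 1) (by omega) (by omega)
        (by omega)
      refine ⟨i', j', hi', hj', ?_⟩
      have hrun := reach_run w out rev L i j p (by rintro (_ | _ | _) <;> simp [counts] <;> omega)
        (D.start b)
      have hlen : (D.start b).1.length ≤ (D.prog false).length + (D.prog true).length := by
        cases b <;> simp [start]
      have := (hread.trans (hrun.trans h)).mono (T' := (w.length + 1) *
        (((D.prog false).length + (D.prog true).length + 1) * (2 * L + 3) + 2)) (by
          have := Nat.mul_le_mul_right (2 * L + 3) hlen
          nlinarith)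
      simpa [transduce, add_assoc, add_comm 1] using this
    · obtain ⟨i', j', hi', hj', h⟩ := ih rev (i + 1) 0 (p + 1) (by omega) (by omega) (by omega)
      refine ⟨i', j', hi', hj', ?_⟩
      have hrow : D.Reach 1 .nextRow (contents w out rev 0 (counts i j p)) (.clear .col false)
          (contents w out rev 0 (counts (i + 1) j (p + 1))) := by
        refine Reach.single fun v => ⟨v, ?_⟩
        simp only [code, TM2.stepAux, contents_counter, update_contents_counter]
        congr 2
        funext q
        cases q <;> simp [counts]
      have hclear := reach_clear (D := D) w out rev 0 (counts (i + 1) j (p + 1)) .col false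
      have hupd : Function.update (counts (i + 1) j (p + 1)) .col 0 = counts (i + 1) 0 (p + 1) := by
        funext q
        cases q <;> simp [counts]
      rw [hupd] at hclear
      have := (hread.trans (hrow.trans (hclear.trans h))).mono (T' := (w.length + 1) *
        (((D.prog false).length + (D.prog true).length + 1) * (2 * L + 3) + 2)) (by
          simp only [counts]
          nlinarith)
      simpa [transduce, add_assoc, add_comm 1] using this
    · obtain ⟨i', j', hi', hj', h⟩ := ih (D.endMark :: rev) 0 j (p + 1) (by omega) (by omega)
        (by omega)
      refine ⟨i', j', hi', hj', ?_⟩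
      have hrow : D.Reach 1 .nextGraph (contents w out rev 0 (counts i j p)) (.clear .row false)
          (contents w out (D.endMark :: rev) 0 (counts i j (p + 1))) := by
        refine Reach.single fun v => ⟨v, ?_⟩
        simp only [code, TM2.stepAux, contents_counter, contents_rev, update_contents_counter,
          update_contents_rev]
        congr 2
        funext q
        cases q <;> simp [counts]
      have hclear := reach_clear (D := D) w out (D.endMark :: rev) 0 (counts i j (p + 1)) .row false
      have hupd : Function.update (counts i j (p + 1)) .row 0 = counts 0 j (p + 1) := by
        funext q
        cases q <;> simp [counts]
      rw [hupd] at hclear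
      have := (hread.trans (hrow.trans (hclear.trans h))).mono (T' := (w.length + 1) *
        (((D.prog false).length + (D.prog true).length + 1) * (2 * L + 3) + 2)) (by
          simp only [counts]
          nlinarith)
      simpa [transduce, add_assoc, add_comm 1] using this

theorem length_flatMap_instrOutput_le (L : ℕ) (hc : ∀ q, c q ≤ L) (l : List (Instr Ω)) :
    (l.flatMap (D.instrOutput c)).length ≤ l.length * (D.width * L + 1) := by
  induction l with
  | nil => simp
  | cons a l ih =>
    have : (D.instrOutput c a).length ≤ D.width * L + 1 := by
      rcases a with a | q
      · simp [instrOutput]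
      · simpa [instrOutput] using (Nat.mul_le_mul_left D.width (hc q)).trans (Nat.le_succ _)
    simp only [List.flatMap_cons, List.length_append, List.length_cons]
    nlinarith

/-- The output is reversed symbol by symbol, so its length enters the running time. -/
theorem length_transduce_le (L : ℕ) (w : List GraphSymbol) (i j p : ℕ) (hi : i + w.length ≤ L)
    (hj : j + w.length ≤ L) (hp : p + w.length ≤ L) :
    (D.transduce w i j p).length ≤
      w.length * (((D.prog false).length + (D.prog true).length) * (D.width * L + 1) + 1) := by
  induction w generalizing i j p with
  | nil => simp [transduce]
  | cons a w ih =>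
    simp only [List.length_cons] at hi hj hp ⊢
    rcases a with b | _ | _
    · have h1 := ih i (j + 1) (p + 1) (by omega) (by omega) (by omega)
      have h2 := length_flatMap_instrOutput_le (D := D) (counts i j p) L
        (by rintro (_ | _ | _) <;> simp [counts] <;> omega) (D.prog b)
      have hlen : (D.prog b).length ≤ (D.prog false).length + (D.prog true).length := by
        cases b <;> simp
      have h3 := Nat.mul_le_mul_right (D.width * L + 1) hlen
      simp only [transduce, List.length_append]
      nlinarith
    · have h1 := ih (i + 1) 0 (p + 1) (by omega) (by omega) (by omega)
      rw [add_one_mul]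
      exact h1.trans (Nat.le_add_right _ _)
    · have h1 := ih 0 j (p + 1) (by omega) (by omega) (by omega)
      rw [add_one_mul]
      exact Nat.add_le_add h1 (Nat.le_add_left _ _)

variable (D)

/-- A bound on the running time. -/
noncomputable def timeBound : Polynomial ℕ :=
  .X * (((D.prog false).length + (D.prog true).length + 1) * (2 * .X + 3) + 2) +
    .X * (((D.prog false).length + (D.prog true).length) * (D.width * .X + 1) + 1) + 3 * .X + 5

theorem evalsTo_output (w : List GraphSymbol) :
    Nonempty (StateTransition.EvalsToInTime (TM2.step D.code)
      ⟨some .read, none, contents w [] [] 0 (counts 0 0 0)⟩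
      (some ⟨none, none, contents [] (D.output w) [] 0 (counts 0 0 0)⟩)
      (D.timeBound.eval w.length)) := by
  obtain ⟨i, j, hi, hj, h⟩ := reach_read (D := D) [] [] w.length w 0 0 0 (by simp) (by simp)
    (by simp)
  have hread : D.Reach 1 .read (contents [] [] ((D.transduce w 0 0 0).reverse ++ []) 0
      (counts i j (0 + w.length))) (.clear .row true)
      (contents [] [] ((D.transduce w 0 0 0).reverse ++ []) 0 (counts i j (0 + w.length))) :=
    Reach.single fun v => ⟨none, by simp [code, contents_inp, update_contents_inp, afterRead]⟩
  have hrow := reach_clear (D := D) [] [] ((D.transduce w 0 0 0).reverse ++ []) 0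
    (counts i j (0 + w.length)) .row true
  have hcol := reach_clear (D := D) [] [] ((D.transduce w 0 0 0).reverse ++ []) 0
    (Function.update (counts i j (0 + w.length)) .row 0) .col true
  have hupd : Function.update (Function.update (counts i j (0 + w.length)) .row 0) .col 0 =
      counts 0 0 w.length := by
    funext q
    cases q <;> simp [counts]
  rw [hupd] at hcol
  have hflush := reach_flush (D := D) [] [] ((D.transduce w 0 0 0).reverse ++ []) 0
    (counts 0 0 w.length)
  obtain ⟨v, ⟨h1⟩⟩ := (h.trans (hread.trans (hrow.trans (hcol.trans hflush)))) none
  obtain ⟨h2⟩ := evalsTo_count (D := D) []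
    (D.endMark :: (((D.transduce w 0 0 0).reverse ++ []).reverse ++ [])) [] 0
    (counts 0 0 w.length) v
  have hupd' : Function.update (counts 0 0 w.length) .pos 0 = counts 0 0 0 := by
    funext q
    cases q <;> simp [counts]
  rw [hupd'] at h2
  have h3 := h1.trans _ _ _ _ _ _ h2
  have hout : List.replicate (D.width * counts 0 0 w.length .pos) D.tick ++
      D.endMark :: (((D.transduce w 0 0 0).reverse ++ []).reverse ++ []) = D.output w := by
    simp [output, counts]
  rw [hout] at h3
  refine ⟨⟨h3.toEvalsTo, h3.steps_le_m.trans ?_⟩⟩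
  have hlen := length_transduce_le (D := D) w.length w 0 0 0 (by simp) (by simp) (by simp)
  simp only [timeBound, Polynomial.eval_add, Polynomial.eval_mul, Polynomial.eval_X,
    Polynomial.eval_natCast, Polynomial.eval_one, Polynomial.eval_ofNat, List.append_nil,
    List.length_reverse]
  simp only [counts, Function.update, Nat.cast_id] at *
  simp
  omega

instance : Finite GraphSymbol := GraphSymbol.finite

/-- The machine that computes the output of the transducer. -/
noncomputable def machine [Finite Ω] : FinTM2 :=
  have := Fintype.ofFinite GraphSymbol
  have := Fintype.ofFinite Ω
  have := Fintype.ofFinite D.Rest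
  { K := Stack
    k₀ := .inp
    k₁ := .out
    Γ := StackAlphabet Ω
    Λ := Label D.Rest
    main := .read
    σ := Memory Ω
    initialState := none
    Γk₀Fin := inferInstanceAs (Fintype GraphSymbol)
    m := D.code }

/-- A function is computable in polynomial time if on the level of words it is the output of a
transducer. -/
theorem computable_of_output [Finite Ω] {α β : Type} (ea : α → List GraphSymbol)
    (eb : β → List Ω) (F : α → β) (h : ∀ x, eb (F x) = D.output (ea x)) :
    Nonempty (TM2ComputableInPolyTime ea eb F) := by
  have key : ∀ x, Nonempty (TM2OutputsInTime D.machine (ea x) (some (eb (F x)))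
      (D.timeBound.eval (ea x).length)) := by
    intro x
    rw [h]
    have h1 : initList D.machine (ea x) =
        ⟨some .read, none, contents (ea x) [] [] 0 (counts 0 0 0)⟩ := by
      simp only [initList]
      congr 1
      funext k
      rcases k with _ | _ | _ | _ | (_ | _ | _) <;> rfl
    have h2 : haltList D.machine (D.output (ea x)) =
        ⟨none, none, contents [] (D.output (ea x)) [] 0 (counts 0 0 0)⟩ := by
      simp only [haltList]
      congr 1
      funext k
      rcases k with _ | _ | _ | _ | (_ | _ | _) <;> rfl
    obtain ⟨h3⟩ := D.evalsTo_output (ea x)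
    exact ⟨⟨⟨h3.steps, (congrArg (fun a => (flip bind (TM2.step D.code))^[h3.steps] (some a))
      h1).trans (h3.evals_in_steps.trans (congrArg some h2.symm))⟩, h3.steps_le_m⟩⟩
  have hi : ∀ l : List GraphSymbol, List.map (Equiv.refl GraphSymbol).invFun l = l :=
    fun l => List.map_id l
  have ho : ∀ l : List Ω, List.map (Equiv.refl Ω).invFun l = l := fun l => List.map_id l
  exact ⟨{
    tm := D.machine
    inputAlphabet := Equiv.refl GraphSymbol
    outputAlphabet := Equiv.refl Ω
    time := D.timeBound
    outputsFun := fun x => Classical.choice (by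
      have := key x
      rw [← hi (ea x), ← ho (eb (F x)), List.length_map] at this
      exact this) }⟩

end Transducer

/-! ### Transducing adjacency matrices -/

namespace Transducer

variable {Ω : Type} (D : Transducer Ω)

/-- The columns in `l` are consecutive and begin with `k`, which is the value of the column counter;
this form of the statement allows an induction on `l`. -/
theorem transduce_bits {m : ℕ} (f : Fin m → Bool) (i p : ℕ) (rest : List GraphSymbol)
    (l : List (Fin m)) (k : ℕ) (hl : l.map Fin.val = List.range' k l.length) :
    D.transduce (l.flatMap (fun j => [GraphSymbol.bit (f j)]) ++ rest) i k (p + k) =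
      l.flatMap (fun j => (D.prog (f j)).flatMap (D.instrOutput (counts i j (p + j)))) ++
        D.transduce rest i (k + l.length) (p + (k + l.length)) := by
  induction l generalizing k with
  | nil => simp
  | cons a l ih =>
    simp only [List.map_cons, List.length_cons, List.range'_succ, List.cons.injEq] at hl
    obtain ⟨rfl, hl⟩ := hl
    have := ih (a + 1) hl
    simp only [List.flatMap_cons, List.cons_append, List.nil_append, transduce, List.append_assoc,
      List.length_cons]
    rw [add_assoc p, this]
    simp only [add_assoc, add_comm 1]

theorem transduce_rows {m : ℕ} (G : SimpleGraph (Fin m)) (off : ℕ) (rest : List GraphSymbol)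
    (l : List (Fin m)) (k : ℕ) (hl : l.map Fin.val = List.range' k l.length) :
    D.transduce ((l.map (adjRow G)).flatMap encodeRow ++ rest) k 0 (off + k * (m + 1)) =
      l.flatMap (fun i => (List.finRange m).flatMap fun j =>
        open Classical in (D.prog (decide (G.Adj i j))).flatMap
          (D.instrOutput (counts i j (off + i * (m + 1) + j)))) ++
        D.transduce rest (k + l.length) 0 (off + (k + l.length) * (m + 1)) := by
  classical
  induction l generalizing k with
  | nil => simp
  | cons a l ih =>
    simp only [List.map_cons, List.length_cons, List.range'_succ, List.cons.injEq] at hl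
    obtain ⟨rfl, hl⟩ := hl
    have hrow := D.transduce_bits (fun j => decide (G.Adj a j)) a (off + a * (m + 1))
      (GraphSymbol.endRow :: ((l.map (adjRow G)).flatMap encodeRow ++ rest)) (List.finRange m) 0
      (by simp [List.range_eq_range'])
    have henc : ((a :: l).map (adjRow G)).flatMap encodeRow ++ rest =
        (List.finRange m).flatMap (fun j => [GraphSymbol.bit (decide (G.Adj a j))]) ++
          GraphSymbol.endRow :: ((l.map (adjRow G)).flatMap encodeRow ++ rest) := by
      simp [encodeRow, adjRow, List.flatMap_map]
    have := ih (a + 1) hl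
    rw [add_one_mul] at this
    rw [henc, ← add_zero (off + a * (m + 1)), hrow]
    simp only [transduce, List.length_finRange, zero_add, List.flatMap_cons, List.length_cons,
      List.append_assoc]
    rw [show off + a * (m + 1) + m + 1 = off + (a * (m + 1) + (m + 1)) by omega, this,
      show a.val + 1 + l.length = a + (l.length + 1) by omega]

theorem transduce_encodeGraph {m : ℕ} (G : SimpleGraph (Fin m)) (off : ℕ)
    (rest : List GraphSymbol) :
    D.transduce (encodeGraph G ++ rest) 0 0 off =
      (List.finRange m).flatMap (fun i => (List.finRange m).flatMap fun j =>
        open Classical in (D.prog (decide (G.Adj i j))).flatMap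
          (D.instrOutput (counts i j (off + i * (m + 1) + j)))) ++
        D.endMark :: D.transduce rest 0 0 (off + m * (m + 1) + 1) := by
  have := D.transduce_rows G off (GraphSymbol.endGraph :: rest) (List.finRange m) 0
    (by simp [List.range_eq_range'])
  simpa [encodeGraph, transduce] using this

end Transducer

theorem length_encodeGraph {m : ℕ} (G : SimpleGraph (Fin m)) :
    (encodeGraph G).length = m * (m + 1) + 1 := by
  simp [encodeGraph, encodeRow, adjRow, List.length_flatMap, Function.comp_def]

/-! ### The reduction -/

/-- An argument of a constraint application that depends on counters: a constant, or the variable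
whose index is twelve times a counter plus `k`. -/
inductive Slot : Type
  | const (b : Bool)
  | var (q : Counter) (k : ℕ)

/-- The argument described by a slot; the constant is only used if the index is too large. -/
def Slot.toArg (N : ℕ) (c : Counter → ℕ) : Slot → Fin N ⊕ Bool
  | .const b => Sum.inr b
  | .var q k => if h : 12 * c q + k < N then Sum.inl ⟨12 * c q + k, h⟩ else Sum.inr false

/-- The index described by a slot is in range. -/
def Slot.Fits (N : ℕ) (c : Counter → ℕ) : Slot → Prop
  | .const _ => True
  | .var q k => 12 * c q + k < N

/-- Three slots and their twins. -/
abbrev Template : Type := Fin 3 × Bool → Slot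

/-- The application for copies `c` and `c'` of the variable of the current row. -/
def copyTemplate (b : Bool) (c c' : Fin 5) : Template :=
  roles (fun s => .var .row (2 * c + s.toNat)) (fun s => .var .row (2 * c' + s.toNat))
    (fun s => .const (xor b s))

/-- The application for the edge in the current row and column. The counter `pos` does not take
the same value for two pairs of vertices. -/
def edgeTemplate : Template :=
  roles (fun s => .var .row s.toNat) (fun s => .var .col s.toNat)
    (fun s => .var .pos (10 + s.toNat))

/-- The applications for an entry of the adjacency matrix. Those for the copies are repeated in
every column, so that nothing has to be written at the end of a row. -/
def templates (b : Bool) (adj : Bool) : List Template :=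
  (List.finRange 5).flatMap (fun c => (List.finRange 5).map (copyTemplate b c)) ++
    if adj then [edgeTemplate] else []

section Reduction

variable {𝒞 : Finset Constraint} (con : {C : Constraint // C ∈ 𝒞})
  (arg : Fin con.1.arity → (Fin 3 × Bool) ⊕ Bool) (b : Bool)

/-- The instructions that write an argument. -/
def Slot.instrs (𝒞 : Finset Constraint) : Slot → List (Instr (IsoSymbol 𝒞))
  | .const b => [.emit (Sum.inr (ArgSymbol.const b))]
  | .var q k => .unary q :: (List.replicate k (.emit (Sum.inr ArgSymbol.tick)) ++
      [.emit (Sum.inr ArgSymbol.endMark)])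

/-- The constraint application described by a template: its slots take the places of the variables
in the parity constraint given by `arg`. -/
def templateApplication (N : ℕ) (c : Counter → ℕ) (t : Template) : Application 𝒞 N where
  con := con
  arg a := Sum.elim (fun r => (t r).toArg N c) Sum.inr (arg a)

/-- The instructions that write the constraint application described by a template. -/
def templateInstrs (t : Template) : List (Instr (IsoSymbol 𝒞)) :=
  .emit (Sum.inl con) :: (List.finRange con.1.arity).flatMap fun a =>
    Sum.elim (fun r => (t r).instrs 𝒞) (fun s => (Slot.const s).instrs 𝒞) (arg a)

/-- The transducer that writes the systems of two graphs. -/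
def systemTransducer : Transducer (IsoSymbol 𝒞) where
  tick := Sum.inr ArgSymbol.tick
  endMark := Sum.inr ArgSymbol.endMark
  width := 12
  prog adj := (templates b adj).flatMap (templateInstrs con arg)

/-- The system of a graph whose adjacency matrix begins at position `off` of the input word. -/
noncomputable def graphApplications (N off : ℕ) {m : ℕ} (G : SimpleGraph (Fin m)) :
    List (Application 𝒞 N) :=
  (List.finRange m).flatMap fun i => (List.finRange m).flatMap fun j =>
    open Classical in (templates b (decide (G.Adj i j))).map
      (templateApplication con arg N (counts i j (off + i * (m + 1) + j)))

/-- The instance of the isomorphism problem for two graphs. Both systems use the same variables,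
and the number of variables depends on the length of the input only; the variables that a system
does not use are unrestricted. -/
noncomputable def reduction (x : GraphPair) : SetPair 𝒞 where
  n := 12 * x.encode.length
  S := graphApplications con arg b _ 0 x.G
  U := graphApplications con arg b _ (x.m * (x.m + 1) + 1) x.H

variable {con arg b}

theorem Slot.flatMap_instrs {N : ℕ} {c : Counter → ℕ} {t : Slot} (h : t.Fits N c) :
    (t.instrs 𝒞).flatMap ((systemTransducer con arg b).instrOutput c) =
      encodeArg 𝒞 (t.toArg N c) := by
  rcases t with s | ⟨q, k⟩
  · simp [Slot.instrs, Slot.toArg, encodeArg, Transducer.instrOutput]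
  · have h' : 12 * c q + k < N := h
    simp [Slot.instrs, Slot.toArg, encodeArg, encodeNat, Transducer.instrOutput, h',
      systemTransducer, List.flatMap_replicate]
    rw [← List.append_assoc, List.replicate_append_replicate]

theorem flatMap_templateInstrs {N : ℕ} {c : Counter → ℕ} {t : Template}
    (h : ∀ r, (t r).Fits N c) :
    (templateInstrs con arg t).flatMap ((systemTransducer con arg b).instrOutput c) =
      encodeApplication (templateApplication con arg N c t) := by
  simp only [templateInstrs, encodeApplication, List.flatMap_cons, List.flatMap_assoc]
  refine congrArg (List.cons (Sum.inl con)) (List.flatMap_congr fun a _ => ?_)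
  simp only [templateApplication]
  rcases arg a with r | s
  · exact Slot.flatMap_instrs (h r)
  · exact Slot.flatMap_instrs (t := .const s) (N := N) trivial

theorem fits_of_mem_templates {N L : ℕ} {c : Counter → ℕ} (hc : ∀ q, c q < L) (hN : N = 12 * L)
    {adj : Bool} {t : Template} (ht : t ∈ templates b adj) (r : Fin 3 × Bool) :
    (t r).Fits N c := by
  have h0 := hc .row
  have h1 := hc .col
  have h2 := hc .pos
  have hs := Bool.toNat_le r.2
  simp only [templates, List.mem_append, List.mem_flatMap, List.mem_map, List.mem_finRange,
    true_and] at ht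
  rcases ht with ⟨k, k', rfl⟩ | ht
  · obtain ⟨r, s⟩ := r
    fin_cases r <;> simp [copyTemplate, roles, Slot.Fits] at hs ⊢ <;> omega
  · cases adj
    · simp at ht
    · simp only [if_true, List.mem_singleton] at ht
      subst ht
      obtain ⟨r, s⟩ := r
      fin_cases r <;> simp [edgeTemplate, roles, Slot.Fits] at hs ⊢ <;> omega

/-- The entries of an adjacency matrix precede the end of its code. -/
theorem counts_lt {L off m : ℕ} (hL : off + m * (m + 1) ≤ L) (i j : Fin m) (q : Counter) :
    counts i j (off + i * (m + 1) + j) q < L := by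
  have hi := i.2
  have hj := j.2
  have h1 : i.val * (m + 1) + (m + 1) ≤ m * (m + 1) := by
    rw [← add_one_mul]
    exact Nat.mul_le_mul_right _ hi
  have h2 : m ≤ m * (m + 1) := Nat.le_mul_of_pos_right _ (Nat.succ_pos _)
  cases q <;> simp only [counts] <;> omega

theorem transduce_graph {N L off : ℕ} (hN : N = 12 * L) {m : ℕ} (hL : off + m * (m + 1) ≤ L)
    (G : SimpleGraph (Fin m)) (rest : List GraphSymbol) :
    (systemTransducer con arg b).transduce (encodeGraph G ++ rest) 0 0 off =
      encodeApplications (graphApplications con arg b N off G) ++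
        (systemTransducer con arg b).transduce rest 0 0 (off + m * (m + 1) + 1) := by
  rw [Transducer.transduce_encodeGraph]
  simp only [encodeApplications, graphApplications, List.flatMap_assoc, List.flatMap_map,
    List.append_assoc, List.cons_append, List.nil_append]
  congr 1
  refine List.flatMap_congr fun i _ => List.flatMap_congr fun j _ => ?_
  simp only [systemTransducer, List.flatMap_assoc]
  exact List.flatMap_congr fun t ht =>
    flatMap_templateInstrs (fits_of_mem_templates (counts_lt hL i j) hN ht)

theorem encode_reduction (x : GraphPair) :
    (reduction con arg b x).encode = (systemTransducer con arg b).output x.encode := by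
  have hlen : x.encode.length = x.m * (x.m + 1) + 1 + (x.n * (x.n + 1) + 1) := by
    simp [GraphPair.encode, length_encodeGraph]
  have h2 := transduce_graph (con := con) (arg := arg) (b := b) (N := 12 * x.encode.length) rfl
    (off := x.m * (x.m + 1) + 1) (by omega) x.H []
  rw [List.append_nil] at h2
  rw [Transducer.output]
  conv_rhs => rw [GraphPair.encode]
  rw [transduce_graph (N := 12 * x.encode.length) rfl (by omega), zero_add, h2]
  simp [SetPair.encode, reduction, encodeNat, systemTransducer, Transducer.transduce,
    GraphPair.encode]

/-- The indices of the variables that describe a graph. Modulo twelve, the copies of vertex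
variables and their twins occupy the residues from `0` to `9`, the variables of pairs and their
twins the residues `10` and `11`; `off + i * (m + 1) + j` is the position of the bit of `(i, j)`, as
a row consists of `m` bits and an end mark. -/
def graphIndex (off : ℕ) {m : ℕ} : GraphVar m → ℕ
  | (Sum.inl (i, c), s) => 12 * i + (2 * c + s.toNat)
  | (Sum.inr (i, j), s) => 12 * (off + i * (m + 1) + j) + (10 + s.toNat)

theorem graphIndex_injective (off m : ℕ) :
    Function.Injective (graphIndex off : GraphVar m → ℕ) := by
  rintro ⟨⟨i, c⟩ | ⟨i, j⟩, s⟩ ⟨⟨i', c'⟩ | ⟨i', j'⟩, s'⟩ h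
  all_goals
    have hs := Bool.toNat_le s
    have hs' := Bool.toNat_le s'
    simp only [graphIndex] at h
  · have h1 : i = i' := by omega
    have h2 : c = c' := by omega
    have h3 : s = s' := by cases s <;> cases s' <;> simp at h ⊢ <;> omega
    rw [h1, h2, h3]
  · omega
  · omega
  · have h3 : s = s' := by cases s <;> cases s' <;> simp at h ⊢ <;> omega
    have h4 : j.val + (m + 1) * i = j' + (m + 1) * i' := by
      rw [mul_comm _ i.val, mul_comm _ i'.val]
      omega
    have hj : j.val = j' := by
      have := congrArg (· % (m + 1)) h4
      simpa [Nat.add_mul_mod_self_left, Nat.mod_eq_of_lt (j.2.trans (Nat.lt_succ_self m)),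
        Nat.mod_eq_of_lt (j'.2.trans (Nat.lt_succ_self m))] using this
    have hi : i.val = i' := by
      rw [hj] at h4
      exact Nat.eq_of_mul_eq_mul_left (Nat.succ_pos m) (Nat.add_left_cancel h4)
    rw [Fin.ext hi, Fin.ext hj, h3]

theorem graphIndex_lt {L off m : ℕ} (hL : off + m * (m + 1) ≤ L) (u : GraphVar m) :
    graphIndex off u < 12 * L := by
  rcases u with ⟨⟨i, c⟩ | ⟨i, j⟩, s⟩
  all_goals
    have hs := Bool.toNat_le s
    simp only [graphIndex]
  · have := counts_lt hL i i .row
    simp only [counts] at this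
    omega
  · have := counts_lt hL i j .pos
    simp only [counts] at this
    omega

/-- The variables that describe a graph as variables of the reduction. -/
def graphEmbedding {L off m : ℕ} (hL : off + m * (m + 1) ≤ L) : GraphVar m ↪ Fin (12 * L) where
  toFun u := ⟨graphIndex off u, graphIndex_lt hL u⟩
  inj' _ _ h := graphIndex_injective off m (by simpa using h)

/-- The system written by the reduction is the one that describes the graph. -/
theorem satisfies_graphApplications {p : Fin 3 → Prop}
    (harg : ∀ v : Fin 3 × Bool → Bool,
      con.1.fn (fun c => Sum.elim v id (arg c)) = true ↔ TwinParity b p v)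
    {L off m : ℕ} (hL : off + m * (m + 1) ≤ L) (G : SimpleGraph (Fin m))
    (I : Fin (12 * L) → Bool) :
    Satisfies I (graphApplications con arg b (12 * L) off G) ↔
      I ∈ graphSolutions b p G (graphEmbedding hL) := by
  classical
  have heval : ∀ c t, (templateApplication con arg (12 * L) c t).eval I = true ↔
      TwinParity b p fun r => Sum.elim I id ((t r).toArg (12 * L) c) := by
    intro c t
    rw [← harg]
    unfold templateApplication Application.eval
    simp only
    refine iff_of_eq (congrArg (fun w => con.1.fn w = true) (funext fun a => ?_))
    rcases arg a with r | s <;> rfl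
  have hvar : ∀ (i j : Fin m) (q : Counter) (k : ℕ) (u : GraphVar m),
      12 * counts i j (off + i * (m + 1) + j) q + k = graphIndex off u →
      Sum.elim I id ((Slot.var q k).toArg (12 * L) (counts i j (off + i * (m + 1) + j))) =
        (I ∘ graphEmbedding hL) u := by
    intro i j q k u h
    have hlt := graphIndex_lt hL u
    simp only [Slot.toArg, h, hlt, dif_pos]
    rfl
  simp only [Satisfies, graphApplications, List.mem_flatMap, List.mem_map, List.mem_finRange,
    true_and, forall_exists_index, and_imp, graphSolutions, Set.mem_ofPred_eq, GraphSat]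
  have hcopy : ∀ (i j : Fin m) (c c' : Fin 5),
      (fun r => Sum.elim I id ((copyTemplate b c c' r).toArg (12 * L)
        (counts i j (off + i * (m + 1) + j)))) =
      roles (fun s => (I ∘ graphEmbedding hL) (vertexVar i c s))
        (fun s => (I ∘ graphEmbedding hL) (vertexVar i c' s)) (fun s => xor b s) := by
    intro i j c c'
    simp only [copyTemplate]
    rw [comp_roles fun t => Sum.elim I id (Slot.toArg (12 * L) _ t)]
    congr 1
    · funext s
      exact hvar i j _ _ _ rfl
    · funext s
      exact hvar i j _ _ _ rfl
  have hedge : ∀ i j : Fin m,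
      (fun r => Sum.elim I id ((edgeTemplate r).toArg (12 * L)
        (counts i j (off + i * (m + 1) + j)))) =
      roles (fun s => (I ∘ graphEmbedding hL) (vertexVar i 0 s))
        (fun s => (I ∘ graphEmbedding hL) (vertexVar j 0 s))
        (fun s => (I ∘ graphEmbedding hL) (pairVar i j s)) := by
    intro i j
    simp only [edgeTemplate]
    rw [comp_roles fun t => Sum.elim I id (Slot.toArg (12 * L) _ t)]
    congr 1
    · funext s
      exact hvar i j _ _ _ (by simp [graphIndex, counts])
    · funext s
      exact hvar i j _ _ _ (by simp [graphIndex, counts])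
    · funext s
      exact hvar i j _ _ _ rfl
  constructor
  · intro h i j
    refine ⟨fun c c' => ?_, fun hij => ?_⟩
    · rw [← hcopy i j]
      exact (heval _ _).1 (h _ i j (copyTemplate b c c') (by simp [templates]) rfl)
    · rw [← hedge]
      exact (heval _ _).1 (h _ i j edgeTemplate (by simp [templates, hij]) rfl)
  · rintro h A i j t ht rfl
    rw [heval]
    simp only [templates, List.mem_append, List.mem_flatMap, List.mem_map, List.mem_finRange,
      true_and] at ht
    rcases ht with ⟨c, c', rfl⟩ | ht
    · rw [hcopy]
      exact (h i j).1 c c'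
    · by_cases hij : G.Adj i j
      · simp only [hij, decide_true, if_true, List.mem_singleton] at ht
        subst ht
        rw [hedge]
        exact (h i j).2 hij
      · simp [hij] at ht

theorem satisfies_map_rename {n : ℕ} (π : Equiv.Perm (Fin n)) (S : List (Application 𝒞 n))
    (I : Fin n → Bool) :
    Satisfies I (S.map (Application.rename π)) ↔ Satisfies (I ∘ π) S := by
  have h : ∀ A : Application 𝒞 n, (A.rename π).eval I = A.eval (I ∘ π) := by
    intro A
    simp only [Application.eval, Application.rename]
    congr 1
    funext j
    rcases A.arg j with i | s <;> rfl
  simp [Satisfies, h]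

theorem isomorphic_iff {n : ℕ} (S U : List (Application 𝒞 n)) :
    Isomorphic S U ↔ ∃ π : Equiv.Perm (Fin n), ∀ I, Satisfies (I ∘ π) S ↔ Satisfies I U := by
  simp only [Isomorphic, Equivalent, satisfies_map_rename]

theorem isYes_reduction_iff {p : Fin 3 → Prop}
    (harg : ∀ v : Fin 3 × Bool → Bool,
      con.1.fn (fun c => Sum.elim v id (arg c)) = true ↔ TwinParity b p v) (x : GraphPair) :
    GI.IsYes x ↔ (ISOc 𝒞).IsYes (reduction con arg b x) := by
  have hlen : x.encode.length = x.m * (x.m + 1) + 1 + (x.n * (x.n + 1) + 1) := by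
    simp [GraphPair.encode, length_encodeGraph]
  have hG : 0 + x.m * (x.m + 1) ≤ x.encode.length := by omega
  have hH : x.m * (x.m + 1) + 1 + x.n * (x.n + 1) ≤ x.encode.length := by omega
  refine Iff.trans ?_ (isomorphic_iff (graphApplications con arg b (12 * x.encode.length) 0 x.G)
    (graphApplications con arg b _ (x.m * (x.m + 1) + 1) x.H)).symm
  simp only [satisfies_graphApplications harg hG, satisfies_graphApplications harg hH]
  constructor
  · rintro ⟨σ⟩
    exact exists_perm_of_iso _ _ σ
  · rintro ⟨π, hπ⟩
    exact nonempty_iso_of_perm π hπ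

end Reduction

end BoolIso

theorem theorem3p11 (𝒞 : Finset BoolIso.Constraint) (haff : BoolIso.IsAffine 𝒞)
    (hbij : ¬ BoolIso.IsBijunctive 𝒞) :
    BoolIso.PolyTimeManyOneReducible BoolIso.GI (BoolIso.ISOc 𝒞) := by
  unfold BoolIso.IsBijunctive at hbij
  push Not at hbij
  obtain ⟨C, hC, hCb⟩ := hbij
  obtain ⟨b, p, arg, harg⟩ := BoolIso.exists_twinParity (haff C hC) hCb
  have : Finite (BoolIso.IsoSymbol 𝒞) := (BoolIso.ISOc 𝒞).alphabet_finite
  exact ⟨BoolIso.reduction ⟨C, hC⟩ arg b,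
    (BoolIso.systemTransducer ⟨C, hC⟩ arg b).computable_of_output _ _ _ BoolIso.encode_reduction,
    BoolIso.isYes_reduction_iff harg⟩
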